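/- For $n\ge 0$ let $\mathfrak S_n$ be the set of permutations $\pi=\pi_1\pi_2\cdots\pi_n$ of $\{1,\dots,n\}$. A permutation contains (an occurrence of) a pattern $\tau\in\mathfrak S_k$ for each $k$-term subsequence of it that is order-isomorphic to $\tau$; it avoids $\tau$ if there is none. A permutation $\pi\in\mathfrak S_n$ is alternating if $\pi_1<\pi_2>\pi_3<\cdots$ (for $n=0,1$ this is no condition). A permutation of length $n\ge2$ in which rises and descents come in turn is called up-down, up-up, down-down or down-up, respectively, if it starts with a rise and ends with a descent, starts and ends with a rise, starts and ends with a descent, or starts with a descent and ends with a rise; no permutation of length $0$ or $1$ is of any of these four types. For $k\ge 1$ let $UD^1_k(x)$, $UU^1_k(x)$, $DD^1_k(x)$, $DU^1_k(x)$ and $A^1_k(x)$ be the ordinary generating functions $\sum_{n\ge0}a_nx^n$, where $a_n$ is the number of up-down, up-up, down-down, down-up and alternating permutations in $\mathfrak S_n$, respectively, that contain $1\text{-}3\text{-}2$ exactly once and avoid $1\text{-}2\text{-}\cdots\text{-}k$. Let $U_r(t)$ be the Chebyshev polynomials of the second kind, $U_{-1}=0$, $U_0=1$, $U_r(t)=2tU_{r-1}(t)-U_{r-2}(t)$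 for $r\ge1$, and write $U_r$ for $U_r\!\left(\frac1{2x}\right)$. Then for all $k\ge3$ the following identities hold (in the field $\mathbb Q((x))$ of formal Laurent series; empty sums are $0$). 1. $\displaystyle UD^1_k(x)=\frac1{U_{k-1}^2}\sum_{j=0}^{k-3}U_{j+1}U_j$. 2. $\displaystyle UU^1_k(x)=\frac1{xU_{k-1}^2}\Bigl(xU_{k-3}^2+\sum_{j=0}^{k-4}U_jU_{j+1}\Bigr)$. 3. $\displaystyle DD^1_k(x)=\frac1{U_{k-1}}\sum_{i=0}^{k-2}x^i\Bigl[\frac{x^{k-1-i}+U_{k-3-i}}{U_{k-1-i}U_{k-2-i}}\Bigl(\sum_{j=0}^{k-2-i}U_jU_{j+1}\Bigr)-xU_{k-2-i}\Bigr]$. 4. $\displaystyle DU^1_k(x)=\frac{x^{k-1}+U_{k-3}}{U_{k-2}}\,UU^1_k(x)+\frac{U_{k-2}}{U_{k-1}}\,DD^1_{k-1}(x)+\frac{xU_{k-3}\,(x^{k-2}+U_{k-4})}{U_{k-2}U_{k-1}}$. 5. $\displaystyle A^1_k(x)=\frac1{xU_{k-1}^2}\Bigl[xU_{k-3}\bigl(U_{k-3}+U_{k-2}\bigr)+(1+x)\sum_{m=0}^{k-4}U_{m+1}U_m\Bigr]$.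 -/

import Mathlib

namespace AltPerm

open Equiv (Perm)

/-! Permutations of `n` letters are elements of `Perm (Fin n)`; the one-line notation of `π` is
`π 0, π 1, …, π (n - 1)`, so positions and letters are counted from `0`. -/

/-- `π` has a rise at the (zero-based) position `i`: the letter there exists, is not the last one,
and is smaller than the next letter. -/
def IsRise {n : ℕ} (π : Perm (Fin n)) (i : ℕ) : Prop :=
  ∃ h : i + 1 < n, π ⟨i, Nat.lt_of_succ_lt h⟩ < π ⟨i + 1, h⟩

/-- `π` has a descent at the (zero-based) position `i`. -/
def IsDescent {n : ℕ} (π : Perm (Fin n)) (i : ℕ) : Prop :=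
  ∃ h : i + 1 < n, π ⟨i + 1, h⟩ < π ⟨i, Nat.lt_of_succ_lt h⟩

/-- Rises and descents of `π` come in turn. -/
def InTurn {n : ℕ} (π : Perm (Fin n)) : Prop :=
  ∀ i : ℕ, i + 2 < n → (IsRise π i ↔ IsDescent π (i + 1))

/-- Up-down: starts with a rise, rises and descents come in turn, ends with a descent.
(As in the three definitions that follow, there is no such permutation of length `0` or `1`.) -/
def IsUpDown {n : ℕ} (π : Perm (Fin n)) : Prop :=
  IsRise π 0 ∧ InTurn π ∧ IsDescent π (n - 2)

/-- Up-up: starts with a rise and ends with a rise. -/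
def IsUpUp {n : ℕ} (π : Perm (Fin n)) : Prop :=
  IsRise π 0 ∧ InTurn π ∧ IsRise π (n - 2)

/-- Down-down: starts with a descent and ends with a descent. -/
def IsDownDown {n : ℕ} (π : Perm (Fin n)) : Prop :=
  IsDescent π 0 ∧ InTurn π ∧ IsDescent π (n - 2)

/-- Down-up: starts with a descent and ends with a rise. -/
def IsDownUp {n : ℕ} (π : Perm (Fin n)) : Prop :=
  IsDescent π 0 ∧ InTurn π ∧ IsRise π (n - 2)

/-- Alternating: `π₁ < π₂ > π₃ < ⋯` in one-based notation, for every length `n ≥ 0`. -/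
def IsAlternating {n : ℕ} (π : Perm (Fin n)) : Prop :=
  ∀ i : ℕ, i + 1 < n → (Even i → IsRise π i) ∧ (Odd i → IsDescent π i)

/-- The subsequence of `π` at the positions `f 0 < f 1 < ⋯ < f (k - 1)` is order-isomorphic
to the pattern `τ`. -/
def IsOccurrence {k n : ℕ} (τ : Perm (Fin k)) (π : Perm (Fin n)) (f : Fin k ↪o Fin n) : Prop :=
  ∀ a b : Fin k, π (f a) < π (f b) ↔ τ a < τ b

/-- `π` avoids the classical pattern `τ`. -/
def Avoids {k n : ℕ} (τ : Perm (Fin k)) (π : Perm (Fin n)) : Prop :=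
  ¬ ∃ f : Fin k ↪o Fin n, IsOccurrence τ π f

/-- `π` contains the classical pattern `τ` exactly once. -/
def ContainsOnce {k n : ℕ} (τ : Perm (Fin k)) (π : Perm (Fin n)) : Prop :=
  ∃! f : Fin k ↪o Fin n, IsOccurrence τ π f

/-- The classical pattern `1-3-2`. -/
def pattern132 : Perm (Fin 3) := Equiv.swap 1 2

/-- The classical pattern `1-2-⋯-k`, the identity permutation of `k` letters. -/
def patternInc (k : ℕ) : Perm (Fin k) := 1

/-- The generating function `∑ₙ aₙ xⁿ`, where `aₙ` is the number of permutations of length `n`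
that lie in the class `P`, contain `1-3-2` exactly once and avoid `1-2-⋯-k`, as an element of the
field of formal Laurent series over `ℚ`. -/
noncomputable def gf (P : ∀ n : ℕ, Perm (Fin n) → Prop) (k : ℕ) : LaurentSeries ℚ :=
  ((PowerSeries.mk fun n : ℕ =>
    (({π : Perm (Fin n) |
        P n π ∧ ContainsOnce pattern132 π ∧ Avoids (patternInc k) π}.ncard : ℕ) : ℚ) :
      PowerSeries ℚ) : LaurentSeries ℚ)

/-- `UD¹` for the pattern `1-2-⋯-k`. -/
noncomputable def UD1 (k : ℕ) : LaurentSeries ℚ := gf (fun _ π => IsUpDown π) k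

/-- `UU¹` for the pattern `1-2-⋯-k`. -/
noncomputable def UU1 (k : ℕ) : LaurentSeries ℚ := gf (fun _ π => IsUpUp π) k

/-- `DD¹` for the pattern `1-2-⋯-k`. -/
noncomputable def DD1 (k : ℕ) : LaurentSeries ℚ := gf (fun _ π => IsDownDown π) k

/-- `DU¹` for the pattern `1-2-⋯-k`. -/
noncomputable def DU1 (k : ℕ) : LaurentSeries ℚ := gf (fun _ π => IsDownUp π) k

/-- `A¹` for the pattern `1-2-⋯-k`. -/
noncomputable def A1 (k : ℕ) : LaurentSeries ℚ := gf (fun _ π => IsAlternating π) k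

/-- The variable `x` of the generating functions. -/
noncomputable def x : LaurentSeries ℚ := ((PowerSeries.X : PowerSeries ℚ) : LaurentSeries ℚ)

/-- `U_r(1 / (2x))`, for the Chebyshev polynomial of the second kind `U_r`; it is nonzero for
`r ≥ 0`, and `U_{-1} = 0`. -/
noncomputable def U (r : ℤ) : LaurentSeries ℚ :=
  Polynomial.aeval (1 / (2 * x)) (Polynomial.Chebyshev.U ℚ r)

end AltPerm

/-! ### Words: the pattern, the zigzag condition and increasing subsequences around a largest
letter. -/

namespace PermList

open List

/-! Cut a nonempty permutation at its largest letter `n`, as `L n R`. If no occurrence of 1-3-2 uses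
`n` as its 3, every letter of `L` exceeds every letter of `R`, so the word is `join` of two smaller
permutations and its occurrences are those of the two parts. If the only occurrence uses `n`, there
is exactly one pair `a` in `L`, `b` in `R` with `a < b`. Then `a` is the last letter of `L`, `b` is
the largest of `R`, and `b = a + 1`; deleting `a` and standardizing gives `joinCross` of two
permutations avoiding 1-3-2, the right one nonempty. `exists_join_or_joinCross` is this dichotomy;
`encard_occ_join` and `encard_occ_joinCross` count the occurrences.

Both constructions respect the other statistics. The step into `n` is a rise and the step out of it
a descent, so the first step of the whole fixes the parity of the length of `L`, and `R` begins with
a rise. An increasing sequence in `L` can be prolonged by `n`, so the left part gets the bound `k -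
1` and the right part keeps `k`. Since the type of the last step is determined by the first step and
the parity of the length, the four types are the classes `cls 1 b e k`.

The decompositions `cls_zero` and `cls_one` become the recurrences `clsGF_zero` and `clsGF_one`.
With no occurrence, their solutions are quotients of Chebyshev polynomials at `1 / (2x)`, up to a
power of `x` in the numerator. With one occurrence the recurrences are linear; multiplied by
suitable Chebyshev factors they telescope to the sums (`F_one_true_true`, `F_one_false_false`) or
give the answer directly (`F_one_true_false`, `F_one_false_true`). -/

/-- A list of natural numbers that is the one-line notation of a permutation of `0, …, n - 1`. -/
def IsPerm (w : List ℕ) : Prop := w.Nodup ∧ ∀ v ∈ w, v < w.length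

/-- The occurrences of the pattern `1-3-2` in a list with distinct entries. -/
def occ (w : List ℕ) : Set (ℕ × ℕ × ℕ) :=
  {t | [t.1, t.2.1, t.2.2] <+ w ∧ t.1 < t.2.2 ∧ t.2.2 < t.2.1}

/-- Rises and descents come in turn, and the first step is a rise iff `b` is `true`. -/
def Zig : Bool → List ℕ → Prop
  | _, [] => True
  | _, [_] => True
  | true, a :: c :: t => a < c ∧ Zig false (c :: t)
  | false, a :: c :: t => c < a ∧ Zig true (c :: t)

/-- Every increasing subsequence has fewer than `k` terms. -/
def NoInc (k : ℕ) (w : List ℕ) : Prop :=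
  ∀ l, l <+ w → l.Pairwise (· < ·) → l.length < k

theorem pair_sublist_cons {a b n : ℕ} {Y : List ℕ} :
    [a, b] <+ n :: Y ↔ (a = n ∧ b ∈ Y) ∨ [a, b] <+ Y := by
  rw [sublist_cons_iff]
  constructor
  · rintro (h | ⟨r, hr, h⟩)
    · exact Or.inr h
    · simp only [cons.injEq] at hr
      obtain ⟨rfl, rfl⟩ := hr
      exact Or.inl ⟨rfl, singleton_sublist.1 h⟩
  · rintro (⟨rfl, h⟩ | h)
    · exact Or.inr ⟨[b], rfl, singleton_sublist.2 h⟩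
    · exact Or.inl h

theorem triple_sublist_cons {a b c n : ℕ} {Y : List ℕ} :
    [a, b, c] <+ n :: Y ↔ (a = n ∧ [b, c] <+ Y) ∨ [a, b, c] <+ Y := by
  rw [sublist_cons_iff]
  constructor
  · rintro (h | ⟨r, hr, h⟩)
    · exact Or.inr h
    · simp only [cons.injEq] at hr
      obtain ⟨rfl, rfl⟩ := hr
      exact Or.inl ⟨rfl, h⟩
  · rintro (⟨rfl, h⟩ | h)
    · exact Or.inr ⟨[b, c], rfl, h⟩
    · exact Or.inl h

theorem pair_sublist_append {a b : ℕ} {X Y : List ℕ} :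
    [a, b] <+ X ++ Y ↔ [a, b] <+ X ∨ (a ∈ X ∧ b ∈ Y) ∨ [a, b] <+ Y := by
  induction X with
  | nil => simp
  | cons x X ih =>
    rw [cons_append, pair_sublist_cons, pair_sublist_cons, ih, mem_append, mem_cons]
    have := @Sublist.subset ℕ [a, b] Y
    simp only [subset_def, mem_cons, not_mem_nil, or_false, forall_eq_or_imp, forall_eq] at this
    tauto

theorem triple_sublist_append {a b c : ℕ} {X Y : List ℕ} :
    [a, b, c] <+ X ++ Y ↔
      [a, b, c] <+ X ∨ ([a, b] <+ X ∧ c ∈ Y) ∨ (a ∈ X ∧ [b, c] <+ Y) ∨ [a, b, c] <+ Y := by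
  induction X with
  | nil => simp
  | cons x X ih =>
    rw [cons_append, triple_sublist_cons, triple_sublist_cons, ih, pair_sublist_append,
      pair_sublist_cons, mem_cons]
    -- What remains is purely propositional in these five statements and the membership conditions.
    generalize ([a, b, c] <+ X) = p₁, ([a, b] <+ X) = p₂, ([b, c] <+ X) = p₃,
      ([a, b, c] <+ Y) = p₄, ([b, c] <+ Y) = p₅
    grind

theorem mem_of_pair {a b : ℕ} {X : List ℕ} (h : [a, b] <+ X) : a ∈ X ∧ b ∈ X :=
  ⟨h.subset (by simp), h.subset (by simp)⟩

theorem mem_of_triple {a b c : ℕ} {X : List ℕ} (h : [a, b, c] <+ X) : a ∈ X ∧ b ∈ X ∧ c ∈ X :=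
  ⟨h.subset (by simp), h.subset (by simp), h.subset (by simp)⟩

theorem mem_occ {a b c : ℕ} {w : List ℕ} :
    (a, b, c) ∈ occ w ↔ [a, b, c] <+ w ∧ a < c ∧ c < b := Iff.rfl

/-- Occurrences of `1-3-2` around a largest entry `n`. -/
theorem mem_occ_peak {L R : List ℕ} {n : ℕ} (hL : ∀ v ∈ L, v < n) (hR : ∀ v ∈ R, v < n)
    {a b c : ℕ} :
    (a, b, c) ∈ occ (L ++ n :: R) ↔ (a, b, c) ∈ occ L ∨ (a, b, c) ∈ occ R ∨
      ([a, b] <+ L ∧ c ∈ R ∧ a < c ∧ c < b) ∨ (a ∈ L ∧ b = n ∧ c ∈ R ∧ a < c) ∨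
      (a ∈ L ∧ [b, c] <+ R ∧ a < c ∧ c < b) := by
  simp only [mem_occ, triple_sublist_append, triple_sublist_cons, pair_sublist_cons, mem_cons]
  constructor
  · rintro ⟨h, hac, hcb⟩
    rcases h with h | ⟨h, rfl | h'⟩ | ⟨h, ⟨rfl, h'⟩ | h'⟩ | ⟨rfl, h⟩ | h
    · tauto
    · have := hL _ (mem_of_pair h).2
      omega
    · tauto
    · tauto
    · tauto
    · have := hR _ (mem_of_pair h).2
      omega
    · tauto
  · rintro (⟨h, h1, h2⟩ | ⟨h, h1, h2⟩ | ⟨h, h1, h2, h3⟩ | ⟨h, rfl, h2, h3⟩ | ⟨h, h1, h2⟩)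
    · tauto
    · tauto
    · tauto
    · have := hR _ h2
      tauto
    · tauto

theorem occ_map {f : ℕ → ℕ} (hf : StrictMono f) (w : List ℕ) :
    occ (w.map f) = (fun t => (f t.1, f t.2.1, f t.2.2)) '' occ w := by
  ext ⟨a, b, c⟩
  simp only [mem_occ, Set.mem_image, sublist_map_iff]
  constructor
  · rintro ⟨⟨l, hl, h⟩, h1, h2⟩
    match l, h with
    | [x, y, z], h =>
      simp only [map_cons, map_nil, cons.injEq, and_true] at h
      obtain ⟨rfl, rfl, rfl⟩ := h
      exact ⟨(x, y, z), ⟨hl, hf.lt_iff_lt.1 h1, hf.lt_iff_lt.1 h2⟩, rfl⟩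
  · rintro ⟨⟨x, y, z⟩, ⟨hl, h1, h2⟩, h⟩
    simp only [Prod.mk.injEq] at h
    obtain ⟨rfl, rfl, rfl⟩ := h
    exact ⟨⟨_, hl, rfl⟩, hf h1, hf h2⟩

theorem encard_occ_map {f : ℕ → ℕ} (hf : StrictMono f) (w : List ℕ) :
    (occ (w.map f)).encard = (occ w).encard := by
  rw [occ_map hf]
  refine Function.Injective.encard_image ?_ _
  rintro ⟨a, b, c⟩ ⟨a', b', c'⟩ h
  simp only [Prod.mk.injEq] at h
  simp [hf.injective h.1, hf.injective h.2.1, hf.injective h.2.2]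

@[simp] theorem occ_nil : occ [] = ∅ := by
  ext ⟨a, b, c⟩
  simp [mem_occ]

theorem occ_singleton (a : ℕ) : occ [a] = ∅ := by
  ext ⟨a, b, c⟩
  simp [mem_occ]

theorem NoInc.map_iff {f : ℕ → ℕ} (hf : StrictMono f) {k : ℕ} {w : List ℕ} :
    NoInc k (w.map f) ↔ NoInc k w := by
  constructor
  · intro h l hl hp
    simpa using h (l.map f) (hl.map f) (List.pairwise_map.2 (hp.imp fun h => hf h))
  · intro h l hl hp
    obtain ⟨l', hl', rfl⟩ := sublist_map_iff.1 hl
    simpa using h l' hl' ((List.pairwise_map.1 hp).imp fun h => hf.lt_iff_lt.1 h)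

theorem Zig.map_iff {f : ℕ → ℕ} (hf : StrictMono f) (w : List ℕ) :
    ∀ b, Zig b (w.map f) ↔ Zig b w := by
  induction w with
  | nil => simp [Zig]
  | cons a t ih =>
    cases t with
    | nil => simp [Zig]
    | cons c t =>
      intro b
      have := ih (!b)
      cases b <;> simp_all [Zig, hf.lt_iff_lt]

/-- The parity of the length of a list: `true` if it is odd. -/
def odd (w : List ℕ) : Bool := w.length.bodd

@[simp] theorem odd_nil : odd [] = false := rfl
@[simp] theorem odd_cons (a : ℕ) (w : List ℕ) : odd (a :: w) = !odd w := by simp [odd]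
@[simp] theorem odd_append (v w : List ℕ) : odd (v ++ w) = (odd v != odd w) := by
  simp [odd, Nat.bodd_add]
@[simp] theorem odd_map (f : ℕ → ℕ) (w : List ℕ) : odd (w.map f) = odd w := by simp [odd]

/-- The step into `n` must be a rise and the step out of it a descent; along an alternating word
this is a parity condition on `L`. The hypothesis on `b` excludes only the word `[n]` with `b =
true`, which satisfies the left side vacuously although the empty `L` has the wrong parity. -/
theorem zig_peak {R : List ℕ} {n : ℕ} (hR : ∀ v ∈ R, v < n) (L : List ℕ) :
    ∀ b, (∀ v ∈ L, v < n) → (L ≠ [] ∨ R ≠ [] ∨ b = false) →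
      (Zig b (L ++ n :: R) ↔ Zig b L ∧ odd L = b ∧ Zig true R) := by
  induction L with
  | nil =>
    intro b _ hb
    cases R with
    | nil => cases b <;> simp_all [Zig]
    | cons r R =>
      have : r < n := hR r (by simp)
      cases b <;> simp [Zig, this, this.le]
  | cons a L ih =>
    intro b hL _
    have ha : a < n := hL a (by simp)
    cases L with
    | nil =>
      have := ih false (by simp) (by simp)
      cases b <;> simp_all [Zig, ha.le]
    | cons a' L =>
      have := ih (!b) (fun v hv => hL v (by simp [hv])) (by simp)
      cases b <;> simp_all [Zig, and_assoc]

/-- The parity condition makes the last step a descent, which a new smallest letter supplies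
automatically. -/
theorem zig_append_valley {a : ℕ} (L : List ℕ) :
    ∀ b, (∀ v ∈ L, a < v) →
      (Zig b (L ++ [a]) ∧ odd (L ++ [a]) = b ↔ Zig b L ∧ odd L = !b) := by
  induction L with
  | nil => intro b _; cases b <;> simp [Zig]
  | cons c L ih =>
    intro b hL
    have hc : a < c := hL c (by simp)
    cases L with
    | nil => cases b <;> simp [Zig, hc]
    | cons a' L =>
      have := ih (!b) (fun v hv => hL v (by simp [hv]))
      cases b <;> simp_all [Zig, and_assoc]

theorem not_noInc_zero (w : List ℕ) : ¬ NoInc 0 w := fun h => by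
  simpa using h [] (nil_sublist _) Pairwise.nil

theorem noInc_nil {k : ℕ} : NoInc k [] ↔ 1 ≤ k := by
  constructor
  · intro h
    exact h [] (nil_sublist _) Pairwise.nil
  · intro h l hl _
    rw [sublist_nil.1 hl]
    exact h

theorem noInc_singleton {k a : ℕ} : NoInc k [a] ↔ 2 ≤ k := by
  constructor
  · intro h
    have := h [a] (Sublist.refl _) (pairwise_singleton _ _)
    simp at this
    omega
  · intro h l hl _
    have := hl.length_le
    simp at this
    omega

/-- An increasing subsequence through `n` ends there, so it is one of `L` with one more term; one
that misses `n` lies in `L`, lies in `R`, or crosses. -/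
theorem noInc_peak {L R : List ℕ} {n k : ℕ} (hL : ∀ v ∈ L, v < n) (hR : ∀ v ∈ R, v < n) :
    NoInc k (L ++ n :: R) ↔ NoInc (k - 1) L ∧ NoInc k R ∧
      ∀ l₁ l₂, l₁ <+ L → l₂ <+ R → l₁ ≠ [] → l₂ ≠ [] → (l₁ ++ l₂).Pairwise (· < ·) →
        (l₁ ++ l₂).length < k := by
  constructor
  · intro h
    refine ⟨fun l hl hp => ?_, fun l hl hp => h l ?_ hp, fun l₁ l₂ h₁ h₂ _ _ hp => h _ ?_ hp⟩
    · have := h (l ++ [n]) (hl.append (by simp)) (by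
        rw [pairwise_append]
        refine ⟨hp, pairwise_singleton _ _, fun a ha b hb => ?_⟩
        rw [mem_singleton.1 hb]
        exact hL a (hl.subset ha))
      simp at this
      omega
    · exact (hl.cons n).trans (sublist_append_right _ _)
    · exact h₁.append (h₂.cons n)
  · rintro ⟨h₁, h₂, h₃⟩ l hl hp
    obtain ⟨l₁, l₂, rfl, hl₁, hl₂⟩ := sublist_append_iff.1 hl
    have hp' := pairwise_append.1 hp
    rcases sublist_cons_iff.1 hl₂ with h | ⟨r, rfl, h⟩
    · by_cases e₁ : l₁ = []
      · subst e₁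
        exact h₂ _ h hp'.2.1
      · by_cases e₂ : l₂ = []
        · subst e₂
          have := h₁ _ hl₁ hp'.1
          simp
          omega
        · exact h₃ _ _ hl₁ h e₁ e₂ hp
    · cases r with
      | nil =>
        have := h₁ _ hl₁ hp'.1
        simp
        omega
      | cons c r =>
        have h4 := hR c (h.subset (by simp))
        have h5 := (pairwise_cons.1 hp'.2.1).1 c (by simp)
        omega

theorem noInc_append_valley {L : List ℕ} {a k : ℕ} (hL : ∀ v ∈ L, a < v) :
    NoInc k (L ++ [a]) ↔ 2 ≤ k ∧ NoInc k L := by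
  constructor
  · intro h
    refine ⟨noInc_singleton.1 fun l hl hp => h l (hl.trans (sublist_append_right L [a])) hp,
      fun l hl hp => h l (hl.trans (sublist_append_left _ _)) hp⟩
  · rintro ⟨h₁, h₂⟩ l hl hp
    obtain ⟨l₁, l₂, rfl, hl₁, hl₂⟩ := sublist_append_iff.1 hl
    have hp' := pairwise_append.1 hp
    by_cases e₁ : l₁ = []
    · subst e₁
      have := hl₂.length_le
      simp at this ⊢
      omega
    · obtain ⟨c, l₁, rfl⟩ := exists_cons_of_ne_nil e₁
      cases l₂ with
      | nil => simpa using h₂ _ hl₁ hp'.1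
      | cons d l₂ =>
        have hd : d = a := by simpa using hl₂.subset (mem_cons_self (a := d) (l := l₂))
        have h3 := hp'.2.2 c (by simp) d (by simp)
        have h4 := hL c (hl₁.subset (by simp))
        omega

end PermList

/-! ### The two ways of composing permutations around the largest letter, and the converse
decomposition. -/

namespace PermList

open List

/-- `L n R` with a largest entry `n` and all entries of `L` above those of `R`. -/
def join (L R : List ℕ) : List ℕ :=
  L.map (· + R.length) ++ (L.length + R.length) :: R

/-- The increasing map that omits the value `r - 1`. -/
def skip (r v : ℕ) : ℕ := if v + 1 < r then v else v + 1

/-- `L a n R` with a largest entry `n`, where `a` is smaller than the largest entry of `R`, and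
these are the only two entries left and right of `n` in increasing order. -/
def joinCross (L R : List ℕ) : List ℕ :=
  (L.map (· + (R.length + 1)) ++ [R.length - 1]) ++ (L.length + R.length + 1) ::
    R.map (skip R.length)

theorem skip_strictMono (r : ℕ) : StrictMono (skip r) := by
  intro a b h
  unfold skip
  split_ifs <;> omega

theorem strictMono_add_const (r : ℕ) : StrictMono (fun v : ℕ => v + r) := fun _ _ h => by
  simpa using h

@[simp] theorem length_join (L R : List ℕ) : (join L R).length = L.length + R.length + 1 := by
  simp [join, add_assoc]

@[simp] theorem length_joinCross (L R : List ℕ) :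
    (joinCross L R).length = L.length + R.length + 2 := by
  simp [joinCross]
  omega

theorem IsPerm.nil : IsPerm [] := by simp [IsPerm]

theorem isPerm_join {L R : List ℕ} (hL : IsPerm L) (hR : IsPerm R) : IsPerm (join L R) := by
  refine ⟨?_, ?_⟩
  · unfold join
    rw [nodup_append, nodup_cons]
    refine ⟨hL.1.map (strictMono_add_const _).injective, ⟨fun h => ?_, hR.1⟩, ?_⟩
    · have := hR.2 _ h
      omega
    · rintro a ha b hb rfl
      obtain ⟨v, hv, rfl⟩ := mem_map.1 ha
      have h1 := hL.2 _ hv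
      rcases mem_cons.1 hb with h | h
      · omega
      · have := hR.2 _ h
        omega
  · intro v hv
    rw [length_join]
    simp only [join, mem_append, mem_map, mem_cons] at hv
    rcases hv with ⟨u, hu, rfl⟩ | rfl | h
    · have := hL.2 _ hu
      omega
    · omega
    · have := hR.2 _ h
      omega

theorem isPerm_joinCross {L R : List ℕ} (hL : IsPerm L) (hR : IsPerm R) (h0 : R ≠ []) :
    IsPerm (joinCross L R) := by
  have h0 := length_pos_iff.2 h0
  refine ⟨?_, ?_⟩
  · unfold joinCross
    rw [nodup_append, nodup_append]
    refine ⟨⟨hL.1.map (strictMono_add_const _).injective, by simp, ?_⟩, nodup_cons.2 ⟨fun h => ?_,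
      hR.1.map (skip_strictMono _).injective⟩, ?_⟩
    · rintro a ha b hb rfl
      obtain ⟨v, hv, rfl⟩ := mem_map.1 ha
      have := mem_singleton.1 hb
      omega
    · obtain ⟨v, hv, h⟩ := mem_map.1 h
      have := hR.2 _ hv
      unfold skip at h
      split_ifs at h <;> omega
    · rintro a ha b hb rfl
      simp only [mem_append, mem_map, mem_cons, not_mem_nil, or_false] at ha hb
      rcases ha with ⟨v, hv, rfl⟩ | rfl <;> rcases hb with h | ⟨u, hu, h⟩
      · have := hL.2 _ hv
        omega
      · have := hR.2 _ hu
        unfold skip at h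
        split_ifs at h <;> omega
      · omega
      · have := hR.2 _ hu
        unfold skip at h
        split_ifs at h <;> omega
  · intro v hv
    rw [length_joinCross]
    simp only [joinCross, mem_append, mem_map, mem_cons, not_mem_nil, or_false] at hv
    rcases hv with (⟨u, hu, rfl⟩ | rfl) | rfl | ⟨u, hu, rfl⟩
    · have := hL.2 _ hu
      omega
    · omega
    · omega
    · have := hR.2 _ hu
      unfold skip
      split_ifs <;> omega

theorem join_left_lt {L : List ℕ} (hL : IsPerm L) (R : List ℕ) :
    ∀ v ∈ L.map (· + R.length), v < L.length + R.length := by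
  intro v hv
  obtain ⟨u, hu, rfl⟩ := mem_map.1 hv
  have := hL.2 _ hu
  omega

theorem join_right_lt {R : List ℕ} (L : List ℕ) (hR : IsPerm R) :
    ∀ v ∈ R, v < L.length + R.length := by
  intro v hv
  have := hR.2 _ hv
  omega

theorem joinCross_left_lt {L R : List ℕ} (hL : IsPerm L) :
    ∀ v ∈ L.map (· + (R.length + 1)) ++ [R.length - 1], v < L.length + R.length + 1 := by
  intro v hv
  simp only [mem_append, mem_map, mem_singleton] at hv
  rcases hv with ⟨u, hu, rfl⟩ | rfl
  · have := hL.2 _ hu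
    omega
  · omega

theorem joinCross_right_lt {R : List ℕ} (L : List ℕ) (hR : IsPerm R) :
    ∀ v ∈ R.map (skip R.length), v < L.length + R.length + 1 := by
  intro v hv
  obtain ⟨u, hu, rfl⟩ := mem_map.1 hv
  have := hR.2 _ hu
  unfold skip
  split_ifs <;> omega

theorem mem_joinCross_left {L : List ℕ} {r v : ℕ} (hr : 0 < r)
    (hv : v ∈ L.map (· + (r + 1)) ++ [r - 1]) : v = r - 1 ∨ r < v := by
  simp only [mem_append, mem_map, mem_singleton] at hv
  rcases hv with ⟨u, hu, rfl⟩ | rfl <;> omega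

theorem mem_joinCross_right {R : List ℕ} {v : ℕ} (hR : IsPerm R)
    (hv : v ∈ R.map (skip R.length)) : v = R.length ∨ v < R.length - 1 := by
  obtain ⟨u, hu, rfl⟩ := mem_map.1 hv
  have := hR.2 _ hu
  unfold skip
  split_ifs <;> omega

/-- A mixed occurrence would need its 1 in the left part below a letter of the right part, or below
its 2 there. -/
theorem occ_join {L R : List ℕ} (hL : IsPerm L) (hR : IsPerm R) :
    occ (join L R) = occ (L.map (· + R.length)) ∪ occ R := by
  have key : ∀ v ∈ L.map (· + R.length), ∀ u ∈ R, u < v := by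
    intro v hv u hu
    obtain ⟨u', hu', rfl⟩ := mem_map.1 hv
    have := hR.2 _ hu
    omega
  ext ⟨a, b, c⟩
  rw [join, mem_occ_peak (join_left_lt hL R) (join_right_lt L hR), Set.mem_union]
  constructor
  · rintro (h | h | ⟨h1, h2, h3, -⟩ | ⟨h1, -, h2, h3⟩ | ⟨h1, h2, h3, -⟩)
    · exact Or.inl h
    · exact Or.inr h
    · have := key _ (mem_of_pair h1).1 _ h2
      omega
    · have := key _ h1 _ h2
      omega
    · have := key _ h1 _ (mem_of_pair h2).2
      omega
  · tauto

theorem encard_occ_join {L R : List ℕ} (hL : IsPerm L) (hR : IsPerm R) :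
    (occ (join L R)).encard = (occ L).encard + (occ R).encard := by
  rw [occ_join hL hR, Set.encard_union_eq, encard_occ_map (strictMono_add_const _)]
  rw [Set.disjoint_left]
  rintro ⟨a, b, c⟩ h1 h2
  have h3 := hR.2 _ (mem_of_triple h2.1).1
  obtain ⟨u, -, hu⟩ := mem_map.1 (mem_of_triple h1.1).1
  simp only at h3 hu
  omega

theorem mem_top_joinCross {R : List ℕ} (hR : ∀ v < R.length, v ∈ R) (h0 : R ≠ []) :
    R.length ∈ R.map (skip R.length) := by
  have h0 := length_pos_iff.2 h0
  refine mem_map.2 ⟨R.length - 1, hR _ (by omega), ?_⟩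
  unfold skip
  split_ifs <;> omega

theorem IsPerm.mem_of_lt {w : List ℕ} (hw : IsPerm w) {v : ℕ} (hv : v < w.length) : v ∈ w := by
  have : w.toFinset = Finset.range w.length := by
    refine Finset.eq_of_subset_of_card_le (fun u hu => ?_) ?_
    · exact Finset.mem_range.2 (hw.2 _ (List.mem_toFinset.1 hu))
    · rw [Finset.card_range, List.toFinset_card_of_nodup hw.1]
  rw [← List.mem_toFinset, this]
  exact Finset.mem_range.2 hv

theorem occ_append_valley {L : List ℕ} {a : ℕ} (h : ∀ v ∈ L, a < v) : occ (L ++ [a]) = occ L := by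
  ext ⟨x, y, z⟩
  simp only [mem_occ, triple_sublist_append, mem_singleton]
  constructor
  · rintro ⟨h1 | ⟨h1, rfl⟩ | ⟨-, h1⟩ | h1, h2, h3⟩
    · exact ⟨h1, h2, h3⟩
    · have := h _ (mem_of_pair h1).1
      omega
    · have := h1.length_le
      simp at this
    · have := h1.length_le
      simp at this
  · tauto

theorem valley_lt (L : List ℕ) (r : ℕ) : ∀ v ∈ L.map (· + (r + 1)), r - 1 < v := by
  intro v hv
  obtain ⟨u, hu, rfl⟩ := mem_map.1 hv
  omega

/-- The only left letter below a right letter is `R.length - 1`, and only `R.length` exceeds it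
there. This pair surrounds the largest letter alone, because `R.length - 1` stands last in the left
part. -/
theorem occ_joinCross {L R : List ℕ} (hL : IsPerm L) (hR : IsPerm R) (h0 : R ≠ []) :
    occ (joinCross L R) = insert (R.length - 1, L.length + R.length + 1, R.length)
      (occ (L.map (· + (R.length + 1))) ∪ occ (R.map (skip R.length))) := by
  have hr := length_pos_iff.2 h0
  ext ⟨a, b, c⟩
  rw [joinCross, mem_occ_peak (joinCross_left_lt hL) (joinCross_right_lt L hR), Set.mem_insert_iff,
    Set.mem_union, occ_append_valley (valley_lt L R.length)]
  constructor
  · rintro (h | h | ⟨h1, h2, h3, h4⟩ | ⟨h1, rfl, h2, h3⟩ | ⟨h1, h2, h3, h4⟩)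
    · tauto
    · tauto
    · rcases mem_joinCross_left hr (mem_of_pair h1).1 with h | h <;>
        rcases mem_joinCross_right hR h2 with h' | h'
      · rcases pair_sublist_append.1 h1 with h5 | ⟨h5, -⟩ | h5
        · have := valley_lt L R.length _ (mem_of_pair h5).1
          omega
        · have := valley_lt L R.length _ h5
          omega
        · have := h5.length_le
          simp at this
      all_goals omega
    · left
      have h4 := mem_joinCross_left hr h1
      have h5 := mem_joinCross_right hR h2
      exact Prod.ext (by change a = R.length - 1; omega)
        (Prod.ext rfl (by change c = R.length; omega))
    · rcases mem_joinCross_left hr h1 with h | h <;>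
        rcases mem_joinCross_right hR (mem_of_pair h2).1 with h' | h' <;>
          rcases mem_joinCross_right hR (mem_of_pair h2).2 with h'' | h'' <;> omega
  · rintro (h | h | h)
    · simp only [Prod.mk.injEq] at h
      obtain ⟨rfl, rfl, rfl⟩ := h
      refine Or.inr (Or.inr (Or.inr (Or.inl ⟨by simp, rfl,
        mem_top_joinCross (fun v hv => hR.mem_of_lt hv) h0, ?_⟩)))
      omega
    · tauto
    · tauto

/-- The crossing pair and the largest entry add one occurrence of `1-3-2` to those in the parts. -/
theorem encard_occ_joinCross {L R : List ℕ} (hL : IsPerm L) (hR : IsPerm R) (h0 : R ≠ []) :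
    (occ (joinCross L R)).encard = (occ L).encard + (occ R).encard + 1 := by
  rw [occ_joinCross hL hR h0, Set.encard_insert_of_notMem, Set.encard_union_eq,
    encard_occ_map (strictMono_add_const _), encard_occ_map (skip_strictMono _)]
  · rw [Set.disjoint_left]
    rintro ⟨a, b, c⟩ h1 h2
    obtain ⟨u, -, hu⟩ := mem_map.1 (mem_of_triple h1.1).1
    have := mem_joinCross_right hR (mem_of_triple h2.1).1
    simp only at hu this
    omega
  · rintro (h | h)
    · obtain ⟨u, -, hu⟩ := mem_map.1 (mem_of_triple h.1).1
      simp only at hu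
      omega
    · have := joinCross_right_lt L hR _ (mem_of_triple h.1).2.1
      simp only at this
      omega

theorem noInc_join {L R : List ℕ} (hL : IsPerm L) (hR : IsPerm R) {k : ℕ} :
    NoInc k (join L R) ↔ NoInc (k - 1) L ∧ NoInc k R := by
  rw [join, noInc_peak (join_left_lt hL R) (join_right_lt L hR),
    NoInc.map_iff (strictMono_add_const _)]
  refine ⟨fun h => ⟨h.1, h.2.1⟩, fun h => ⟨h.1, h.2, ?_⟩⟩
  intro l₁ l₂ h₁ h₂ e₁ e₂ hp
  obtain ⟨c, l₁, rfl⟩ := exists_cons_of_ne_nil e₁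
  obtain ⟨d, l₂, rfl⟩ := exists_cons_of_ne_nil e₂
  have h3 := (pairwise_append.1 hp).2.2 c (by simp) d (by simp)
  obtain ⟨u, -, hu⟩ := mem_map.1 (h₁.subset (mem_cons_self (a := c) (l := l₁)))
  have := hR.2 _ (h₂.subset (mem_cons_self (a := d) (l := l₂)))
  omega

theorem length_le_one_of_forall_eq {l : List ℕ} {a : ℕ} (hl : l.Pairwise (· < ·))
    (h : ∀ v ∈ l, v = a) : l.length ≤ 1 := by
  match l with
  | [] => simp
  | [_] => simp
  | x :: y :: l =>
    have h1 := (pairwise_cons.1 hl).1 y (by simp)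
    have h2 := h x (by simp)
    have h3 := h y (by simp)
    omega

/-- The bound `3 ≤ k` comes from the crossing letter followed by the largest one. A crossing
increasing subsequence has just two terms, so it adds no further condition. -/
theorem noInc_joinCross {L R : List ℕ} (hL : IsPerm L) (hR : IsPerm R) (h0 : R ≠ []) {k : ℕ} :
    NoInc k (joinCross L R) ↔ 3 ≤ k ∧ NoInc (k - 1) L ∧ NoInc k R := by
  have hr := length_pos_iff.2 h0
  rw [joinCross, noInc_peak (joinCross_left_lt hL) (joinCross_right_lt L hR),
    NoInc.map_iff (skip_strictMono _), noInc_append_valley (valley_lt L R.length),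
    NoInc.map_iff (strictMono_add_const _)]
  constructor
  · rintro ⟨⟨h1, h2⟩, h3, -⟩
    exact ⟨by omega, h2, h3⟩
  · rintro ⟨hk, h1, h2⟩
    refine ⟨⟨by omega, h1⟩, h2, ?_⟩
    intro l₁ l₂ h₁ h₂ e₁ e₂ hp
    have hp' := pairwise_append.1 hp
    obtain ⟨c, hc⟩ := exists_mem_of_ne_nil _ e₁
    obtain ⟨d, hd⟩ := exists_mem_of_ne_nil _ e₂
    have key : ∀ x ∈ l₁, ∀ y ∈ l₂, x = R.length - 1 ∧ y = R.length := by
      intro x hx y hy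
      have h3 := hp'.2.2 x hx y hy
      rcases mem_joinCross_left hr (h₁.subset hx) with h | h <;>
        rcases mem_joinCross_right hR (h₂.subset hy) with h' | h' <;> omega
    have h5 := length_le_one_of_forall_eq hp'.1 (fun x hx => (key x hx d hd).1)
    have h6 := length_le_one_of_forall_eq hp'.2.1 (fun y hy => (key c hc y hy).2)
    rw [length_append]
    omega

theorem zig_join {L R : List ℕ} (hL : IsPerm L) (hR : IsPerm R) {b e : Bool}
    (h : L ≠ [] ∨ R ≠ [] ∨ b = false) :
    (Zig b (join L R) ∧ odd (join L R) = e) ↔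
      (Zig b L ∧ odd L = b) ∧ (Zig true R ∧ odd R = (b == e)) := by
  rw [join, zig_peak (join_right_lt L hR) _ _ (join_left_lt hL R) (by simpa using h),
    Zig.map_iff (strictMono_add_const _), odd_append, odd_cons, odd_map]
  cases h1 : odd L <;> cases h2 : odd R <;> cases b <;> cases e <;> simp

theorem zig_joinCross {L R : List ℕ} (hL : IsPerm L) (hR : IsPerm R) {b e : Bool} :
    (Zig b (joinCross L R) ∧ odd (joinCross L R) = e) ↔
      (Zig b L ∧ odd L = !b) ∧ (Zig true R ∧ odd R = (b == e)) := by
  have h1 := zig_append_valley (L.map (· + (R.length + 1))) b (valley_lt L R.length)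
  rw [Zig.map_iff (strictMono_add_const _), odd_map] at h1
  rw [joinCross, zig_peak (joinCross_right_lt L hR) _ _ (joinCross_left_lt hL) (by simp),
    ← and_assoc, h1, Zig.map_iff (skip_strictMono _)]
  simp only [odd_append, odd_cons, odd_map, odd_nil]
  cases h1 : odd L <;> cases h2 : odd R <;> cases b <;> cases e <;> simp

/-- The largest letter occurs once, so its position recovers both parts. -/
theorem join_injective {L R L' R' : List ℕ} (hL : IsPerm L) (hR : IsPerm R)
    (h : join L R = join L' R') : L = L' ∧ R = R' := by
  have hlen : L.length + R.length = L'.length + R'.length := by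
    simpa using congrArg List.length h
  unfold join at h
  rw [← hlen, append_cons_inj_of_notMem] at h
  · obtain ⟨h1, -, rfl⟩ := h
    exact ⟨List.map_injective_iff.2 (strictMono_add_const _).injective h1, rfl⟩
  · intro h
    exact lt_irrefl _ (join_left_lt hL R _ h)
  · intro h
    exact lt_irrefl _ (join_right_lt L hR _ h)

theorem joinCross_injective {L R L' R' : List ℕ} (hL : IsPerm L) (hR : IsPerm R)
    (h : joinCross L R = joinCross L' R') : L = L' ∧ R = R' := by
  have hlen : L.length + R.length = L'.length + R'.length := by
    simpa using congrArg List.length h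
  unfold joinCross at h
  rw [← hlen, append_cons_inj_of_notMem] at h
  · obtain ⟨h1, -, h2⟩ := h
    have h3 : R.length = R'.length := by simpa using congrArg List.length h2
    rw [← h3] at h1 h2
    exact ⟨List.map_injective_iff.2 (strictMono_add_const _).injective
      (List.append_inj_left' h1 rfl), List.map_injective_iff.2 (skip_strictMono _).injective h2⟩
  · intro h
    exact lt_irrefl _ (joinCross_left_lt hL _ h)
  · intro h
    exact lt_irrefl _ (joinCross_right_lt L hR _ h)

/-- In a cross, `R'.length - 1` stands left of the largest letter and `R'.length` right of it; a
join admits no such pair. -/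
theorem join_ne_joinCross {L R L' R' : List ℕ} (hL : IsPerm L) (hR : IsPerm R)
    (hR' : IsPerm R') (h0 : R' ≠ []) : join L R ≠ joinCross L' R' := by
  intro h
  have hr := length_pos_iff.2 h0
  have hlen : L.length + R.length = L'.length + R'.length + 1 := by
    simpa using congrArg List.length h
  unfold join joinCross at h
  rw [← hlen, append_cons_inj_of_notMem] at h
  · obtain ⟨h1, -, h2⟩ := h
    have h3 : R'.length - 1 ∈ L.map (· + R.length) := by rw [h1]; simp
    have h4 := mem_top_joinCross (fun v hv => hR'.mem_of_lt hv) h0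
    rw [← h2] at h4
    obtain ⟨u, -, hu⟩ := mem_map.1 h3
    have := hR.2 _ h4
    omega
  · intro h
    exact lt_irrefl _ (join_left_lt hL R _ h)
  · intro h
    exact lt_irrefl _ (join_right_lt L hR _ h)

theorem map_map_eq_self {f g : ℕ → ℕ} {l : List ℕ} (h : ∀ v ∈ l, f (g v) = v) :
    (l.map g).map f = l := by
  rw [List.map_map]
  conv_rhs => rw [← List.map_id l]
  exact List.map_congr_left (fun v hv => h v hv)

/-- A permutation whose entries left of the largest one exceed those to its right. -/
theorem exists_join {L R : List ℕ} (hw : IsPerm (L ++ (L.length + R.length) :: R))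
    (h : ∀ a ∈ L, ∀ b ∈ R, b < a) :
    ∃ L', IsPerm L' ∧ IsPerm R ∧ L ++ (L.length + R.length) :: R = join L' R := by
  have hn := nodup_append.1 hw.1
  have hn2 := nodup_cons.1 hn.2.1
  have hlt : ∀ v ∈ L ++ (L.length + R.length) :: R, v < L.length + R.length + 1 := by
    intro v hv
    have := hw.2 v hv
    simp only [length_append, length_cons] at this
    omega
  have hmem : ∀ v < L.length + R.length, v ∈ L ∨ v ∈ R := by
    intro v hv
    have := hw.mem_of_lt (v := v) (by simp only [length_append, length_cons]; omega)
    simp only [mem_append, mem_cons] at this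
    rcases this with h | h | h
    · exact Or.inl h
    · omega
    · exact Or.inr h
  have hRlt : ∀ v ∈ R, v < R.length := by
    intro v hv
    -- No letter up to `v` can lie in `L`, so all `v + 1` of them lie in `R`; counting gives the
    -- bound.
    have h1 : Finset.range (v + 1) ⊆ R.toFinset := by
      intro u hu
      have hu := Finset.mem_range.1 hu
      have h2 := hlt v (by simp [hv])
      have h3 : v ≠ L.length + R.length := fun h => hn2.1 (h ▸ hv)
      rcases hmem u (by omega) with h4 | h4
      · have := h u h4 v hv
        omega
      · exact List.mem_toFinset.2 h4
    have := Finset.card_le_card h1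
    rw [Finset.card_range, List.toFinset_card_of_nodup hn2.2] at this
    omega
  have hR : IsPerm R := ⟨hn2.2, hRlt⟩
  have hLge : ∀ v ∈ L, R.length ≤ v := by
    intro v hv
    by_contra! h1
    have := h v hv v (hR.mem_of_lt h1)
    omega
  have hLlt : ∀ v ∈ L, v < L.length + R.length := by
    intro v hv
    have h1 := hlt v (by simp [hv])
    have h2 : v ≠ L.length + R.length := hn.2.2 v hv _ (by simp)
    omega
  have hback : (L.map (· - R.length)).map (· + R.length) = L :=
    map_map_eq_self fun v hv => Nat.sub_add_cancel (hLge v hv)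
  refine ⟨L.map (· - R.length), ⟨?_, ?_⟩, hR, ?_⟩
  · refine hn.1.map_on fun a ha b hb hab => ?_
    have := hLge a ha
    have := hLge b hb
    omega
  · intro v hv
    obtain ⟨u, hu, rfl⟩ := mem_map.1 hv
    have := hLge u hu
    have := hLlt u hu
    rw [length_map]
    omega
  · rw [join, hback, length_map]

/-- A permutation with exactly one occurrence of `1-3-2`, in which the largest entry plays the
role of `3`. -/
theorem exists_joinCross {L R : List ℕ} (hw : IsPerm (L ++ (L.length + R.length) :: R))
    (hocc : (occ (L ++ (L.length + R.length) :: R)).Subsingleton) {a b : ℕ} (ha : a ∈ L)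
    (hb : b ∈ R) (hab : a < b) :
    ∃ L' R', IsPerm L' ∧ IsPerm R' ∧ R' ≠ [] ∧
      L ++ (L.length + R.length) :: R = joinCross L' R' := by
  have hn := nodup_append.1 hw.1
  have hn2 := nodup_cons.1 hn.2.1
  have hlt : ∀ v ∈ L ++ (L.length + R.length) :: R, v < L.length + R.length + 1 := by
    intro v hv
    have := hw.2 v hv
    simp only [length_append, length_cons] at this
    omega
  have hLlt : ∀ v ∈ L, v < L.length + R.length := by
    intro v hv
    have h1 := hlt v (by simp [hv])
    have h2 : v ≠ L.length + R.length := hn.2.2 v hv _ (by simp)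
    omega
  have hRlt : ∀ v ∈ R, v < L.length + R.length := by
    intro v hv
    have h1 := hlt v (by simp [hv])
    have h3 : v ≠ L.length + R.length := fun h => hn2.1 (h ▸ hv)
    omega
  have hmem : ∀ v < L.length + R.length, v ∈ L ∨ v ∈ R := by
    intro v hv
    have := hw.mem_of_lt (v := v) (by simp only [length_append, length_cons]; omega)
    simp only [mem_append, mem_cons] at this
    rcases this with h | h | h
    · exact Or.inl h
    · omega
    · exact Or.inr h
  -- Each such pair forms an occurrence with the largest letter, so uniqueness leaves only one.
  have huniq : ∀ x ∈ L, ∀ y ∈ R, x < y → x = a ∧ y = b := by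
    intro x hx y hy hxy
    have h1 : (x, L.length + R.length, y) ∈ occ (L ++ (L.length + R.length) :: R) :=
      (mem_occ_peak hLlt hRlt).2 (by tauto)
    have h2 : (a, L.length + R.length, b) ∈ occ (L ++ (L.length + R.length) :: R) :=
      (mem_occ_peak hLlt hRlt).2 (by tauto)
    have := hocc h1 h2
    simp only [Prod.mk.injEq] at this
    exact ⟨this.1, this.2.2⟩
  have hne : ∀ x ∈ L, ∀ y ∈ R, x ≠ y := fun x hx y hy => hn.2.2 x hx y (by simp [hy])
  -- `a` is the last entry of `L`
  obtain ⟨L₁, L₂, rfl⟩ := append_of_mem ha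
  have hnL := nodup_append.1 hn.1
  have hL₂ : L₂ = [] := by
    by_contra h0
    obtain ⟨y, hy⟩ := exists_mem_of_ne_nil _ h0
    have hya : a ≠ y := fun h => (nodup_cons.1 hnL.2.1).1 (h ▸ hy)
    have hyL : y ∈ L₁ ++ a :: L₂ := by simp [hy]
    -- Otherwise `y` and `b` would be a second crossing pair. Then `a, y, b` is an occurrence that
    -- does not use the largest letter.
    have hby : b < y := by
      have h1 := hne y hyL b hb
      by_contra! h2
      exact hya (huniq y hyL b hb (by omega)).1.symm
    have h1 := (mem_occ_peak (a := a) (b := y) (c := b) hLlt hRlt).2 (by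
      refine Or.inr (Or.inr (Or.inl ⟨?_, hb, hab, hby⟩))
      exact (Sublist.trans (by simpa using hy) (sublist_append_right L₁ (a :: L₂))))
    have h2 := (mem_occ_peak (b := (L₁ ++ a :: L₂).length + R.length) hLlt hRlt).2
      (Or.inr (Or.inr (Or.inr (Or.inl ⟨ha, rfl, hb, hab⟩))))
    have h3 := hocc h1 h2
    simp only [Prod.mk.injEq] at h3
    have := hLlt y hyL
    omega
  subst hL₂
  have hL₁ : ∀ v ∈ L₁, b < v := by
    intro v hv
    have hvL : v ∈ L₁ ++ [a] := by simp [hv]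
    have h1 := hne v hvL b hb
    have h3 : v ≠ a := hnL.2.2 v hv a (by simp)
    by_contra! h2
    exact h3 (huniq v hvL b hb (by omega)).1
  have hR₁ : ∀ v ∈ R, v = b ∨ v < a := by
    intro v hv
    have h1 := hne a ha v hv
    by_contra! h2
    exact h2.1 (huniq a ha v hv (by omega)).2
  have hbn := hRlt b hb
  -- Left letters other than `a` exceed `b`, and right letters other than `b` lie below `a`, so no
  -- value fits strictly between.
  have hba : b = a + 1 := by
    by_contra h0
    rcases hmem (a + 1) (by omega) with h | h
    · rcases mem_append.1 h with h | h
      · have := hL₁ _ h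
        omega
      · simp at h
    · have := hR₁ _ h
      omega
  have hRset : R.toFinset = insert (a + 1) (Finset.range a) := by
    ext v
    rw [List.mem_toFinset, Finset.mem_insert, Finset.mem_range]
    constructor
    · intro h
      have := hR₁ v h
      omega
    · rintro (rfl | h)
      · exact hba ▸ hb
      · rcases hmem v (by omega) with h1 | h1
        · rcases mem_append.1 h1 with h2 | h2
          · have := hL₁ _ h2
            omega
          · simp at h2
            omega
        · exact h1
  have hRlen : R.length = a + 1 := by
    rw [← List.toFinset_card_of_nodup hn2.2, hRset, Finset.card_insert_of_notMem (by simp),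
      Finset.card_range]
  have hbackL : (L₁.map (· - (R.length + 1))).map (· + (R.length + 1)) = L₁ :=
    map_map_eq_self fun v hv => Nat.sub_add_cancel (by have := hL₁ v hv; omega)
  -- Since `R` consists of `a + 1` and letters below `a`, `min a` lowers its top letter by one and
  -- inverts `skip`.
  have hbackR : (R.map (min a)).map (skip R.length) = R := by
    refine map_map_eq_self fun v hv => ?_
    have := hR₁ v hv
    unfold skip
    split_ifs <;> omega
  refine ⟨L₁.map (· - (R.length + 1)), R.map (min a), ⟨?_, ?_⟩, ⟨?_, ?_⟩, ?_, ?_⟩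
  · refine hnL.1.map_on fun x hx y hy hxy => ?_
    have := hL₁ x hx
    have := hL₁ y hy
    omega
  · intro v hv
    obtain ⟨u, hu, rfl⟩ := mem_map.1 hv
    have := hL₁ u hu
    have := hLlt u (by simp [hu])
    simp only [length_append, length_singleton] at this
    rw [length_map]
    omega
  · refine hn2.2.map_on fun x hx y hy hxy => ?_
    have := hR₁ x hx
    have := hR₁ y hy
    omega
  · intro v hv
    obtain ⟨u, hu, rfl⟩ := mem_map.1 hv
    rw [length_map]
    omega
  · intro h
    simp at h
    simp [h] at hb
  · simp only [joinCross, length_map]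
    rw [hbackL, hbackR, hRlen]
    simp
    omega

theorem exists_join_or_joinCross {w : List ℕ} (hw : IsPerm w) (h0 : w ≠ [])
    (hocc : (occ w).encard ≤ 1) :
    (∃ L R, IsPerm L ∧ IsPerm R ∧ w = join L R) ∨
      ∃ L R, IsPerm L ∧ IsPerm R ∧ R ≠ [] ∧ w = joinCross L R := by
  have hlen := length_pos_iff.2 h0
  obtain ⟨L, R, h⟩ := append_of_mem (hw.mem_of_lt (v := w.length - 1) (by omega))
  have hl : w.length - 1 = L.length + R.length := by
    have := congrArg List.length h
    simp only [length_append, length_cons] at this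
    omega
  rw [hl] at h
  subst h
  by_cases h : ∀ a ∈ L, ∀ b ∈ R, b < a
  · obtain ⟨L', h1, h2, h3⟩ := exists_join hw h
    exact Or.inl ⟨L', R, h1, h2, h3⟩
  · push Not at h
    obtain ⟨a, ha, b, hb, hab⟩ := h
    have hne : a ≠ b := (nodup_append.1 hw.1).2.2 a ha b (by simp [hb])
    obtain ⟨L', R', h1, h2, h3, h4⟩ := exists_joinCross hw (Set.encard_le_one_iff_subsingleton.1 hocc)
      ha hb (by omega)
    exact Or.inr ⟨L', R', h1, h2, h3, h4⟩

end PermList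

/-! ### Classes of words, their decompositions and the resulting recurrences. -/

namespace PermList

open List PowerSeries

/-- The alternating permutations with `c` occurrences of `1-3-2` and without increasing
subsequence of length `k`, with first step given by `b` and with parity of the length given by
`e`. -/
def cls (c : ℕ∞) (b e : Bool) (k : ℕ) : Set (List ℕ) :=
  {w | IsPerm w ∧ (occ w).encard = c ∧ (Zig b w ∧ odd w = e) ∧ NoInc k w}

/-- The elements of length `n` of a set of lists. -/
def slice (C : Set (List ℕ)) (n : ℕ) : Set (List ℕ) := {w | w ∈ C ∧ w.length = n}

/-- The generating function of a set of lists by length. -/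
noncomputable def genFun (C : Set (List ℕ)) : PowerSeries ℚ :=
  PowerSeries.mk fun n => ((slice C n).ncard : ℚ)

theorem finite_slice {C : Set (List ℕ)} (hC : ∀ w ∈ C, IsPerm w) (n : ℕ) : (slice C n).Finite := by
  refine (List.finite_toSet (List.range n).permutations).subset ?_
  rintro w ⟨hw, rfl⟩
  have hp := hC w hw
  change w ∈ (List.range w.length).permutations
  rw [mem_permutations, perm_ext_iff_of_nodup hp.1 nodup_range]
  exact fun v => ⟨fun h => List.mem_range.2 (hp.2 v h), fun h => hp.mem_of_lt (List.mem_range.1 h)⟩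

theorem genFun_empty : genFun ∅ = 0 := by
  ext n
  simp [genFun, slice]

theorem genFun_union {C D : Set (List ℕ)} (hC : ∀ w ∈ C, IsPerm w) (hD : ∀ w ∈ D, IsPerm w)
    (h : Disjoint C D) : genFun (C ∪ D) = genFun C + genFun D := by
  ext n
  have : slice (C ∪ D) n = slice C n ∪ slice D n := by
    ext w
    simp only [slice, Set.mem_union, Set.mem_ofPred_eq, or_and_right]
  rw [map_add, genFun, genFun, genFun, coeff_mk, coeff_mk, coeff_mk, this,
    Set.ncard_union_eq ?_ (finite_slice hC n) (finite_slice hD n), Nat.cast_add]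
  exact h.mono (fun _ hw => hw.1) (fun _ hw => hw.1)

theorem genFun_singleton (w : List ℕ) : genFun {w} = X ^ w.length := by
  ext n
  rw [genFun, coeff_mk, coeff_X_pow]
  split_ifs with h
  · have : slice {w} n = {w} := by
      ext v
      simp only [slice, Set.mem_singleton_iff, Set.mem_ofPred_eq, and_iff_left_iff_imp]
      rintro rfl
      exact h.symm
    simp [this]
  · have : slice {w} n = ∅ := by
      ext v
      simp only [slice, Set.mem_singleton_iff, Set.mem_ofPred_eq, Set.mem_empty_iff_false, iff_false]
      rintro ⟨rfl, rfl⟩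
      exact h rfl
    simp [this]

theorem genFun_image2 {C D : Set (List ℕ)} (hC : ∀ w ∈ C, IsPerm w) (hD : ∀ w ∈ D, IsPerm w)
    {f : List ℕ → List ℕ → List ℕ} {m : ℕ}
    (hf : ∀ L R, (f L R).length = L.length + R.length + m)
    (hinj : ∀ L ∈ C, ∀ R ∈ D, ∀ L' ∈ C, ∀ R' ∈ D, f L R = f L' R' → L = L' ∧ R = R') :
    genFun (Set.image2 f C D) = X ^ m * (genFun C * genFun D) := by
  ext n
  rw [coeff_X_pow_mul', genFun, coeff_mk]
  split_ifs with h
  · let c i := (finite_slice hC i).toFinset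
    let d i := (finite_slice hD i).toFinset
    have hc : ∀ i L, L ∈ c i ↔ L ∈ C ∧ L.length = i := fun i L => by simp [c, slice]
    have hd : ∀ i L, L ∈ d i ↔ L ∈ D ∧ L.length = i := fun i L => by simp [d, slice]
    -- Pairs of total length `n - m`, sorted by the two lengths: injectivity turns their number into
    -- the coefficient of a Cauchy product.
    let S := (Finset.HasAntidiagonal.antidiagonal (n - m)).biUnion fun p => c p.1 ×ˢ d p.2
    have hS : ∀ p, p ∈ S ↔ p.1 ∈ C ∧ p.2 ∈ D ∧ p.1.length + p.2.length = n - m := by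
      rintro ⟨L, R⟩
      simp only [S, Finset.mem_biUnion, Finset.HasAntidiagonal.mem_antidiagonal, Finset.mem_product, hc, hd]
      constructor
      · rintro ⟨⟨i, j⟩, h1, ⟨h2, rfl⟩, h3, rfl⟩
        exact ⟨h2, h3, h1⟩
      · rintro ⟨h1, h2, h3⟩
        exact ⟨(L.length, R.length), h3, ⟨h1, rfl⟩, h2, rfl⟩
    have h1 : slice (Set.image2 f C D) n = (fun p : List ℕ × List ℕ => f p.1 p.2) '' S := by
      ext w
      simp only [slice, Set.mem_image2, Set.mem_ofPred_eq, Set.mem_image, Finset.mem_coe, hS,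
        Prod.exists]
      constructor
      · rintro ⟨⟨L, hL, R, hR, rfl⟩, hn⟩
        rw [hf] at hn
        exact ⟨L, R, ⟨hL, hR, by omega⟩, rfl⟩
      · rintro ⟨L, R, ⟨hL, hR, hn⟩, rfl⟩
        exact ⟨⟨L, hL, R, hR, rfl⟩, by rw [hf]; omega⟩
    rw [h1, Set.InjOn.ncard_image, Set.ncard_coe_finset, coeff_mul, Finset.card_biUnion]
    · push_cast
      refine Finset.sum_congr rfl fun p _ => ?_
      rw [Finset.card_product, genFun, genFun, coeff_mk, coeff_mk,
        Set.ncard_eq_toFinset_card _ (finite_slice hC p.1),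
        Set.ncard_eq_toFinset_card _ (finite_slice hD p.2), Nat.cast_mul]
    · intro p _ q _ hpq
      refine Finset.disjoint_left.2 fun r hr hr' => hpq ?_
      rw [Finset.mem_product, hc, hd] at hr hr'
      exact Prod.ext (hr.1.2.symm.trans hr'.1.2) (hr.2.2.symm.trans hr'.2.2)
    · rintro ⟨L, R⟩ h1 ⟨L', R'⟩ h2 h3
      have h1 := (hS _).1 h1
      have h2 := (hS _).1 h2
      obtain ⟨rfl, rfl⟩ := hinj L h1.1 R h1.2.1 L' h2.1 R' h2.2.1 h3
      rfl
  · have : slice (Set.image2 f C D) n = ∅ := by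
      ext w
      simp only [slice, Set.mem_image2, Set.mem_ofPred_eq, Set.mem_empty_iff_false, iff_false]
      rintro ⟨⟨L, _, R, _, rfl⟩, hn⟩
      rw [hf] at hn
      omega
    simp [this]

theorem genFun_join {c₁ c₂ : ℕ∞} {b₁ b₂ e₁ e₂ : Bool} {k₁ k₂ : ℕ} :
    genFun (Set.image2 join (cls c₁ b₁ e₁ k₁) (cls c₂ b₂ e₂ k₂)) =
      X * (genFun (cls c₁ b₁ e₁ k₁) * genFun (cls c₂ b₂ e₂ k₂)) := by
  rw [genFun_image2 (m := 1) (fun w hw => hw.1) (fun w hw => hw.1) (fun L R => length_join L R),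
    pow_one]
  intro L hL R hR L' _ R' hR' h
  exact join_injective hL.1 hR.1 h

theorem isPerm_of_mem_join {c₁ c₂ : ℕ∞} {b₁ b₂ e₁ e₂ : Bool} {k₁ k₂ : ℕ} :
    ∀ w ∈ Set.image2 join (cls c₁ b₁ e₁ k₁) (cls c₂ b₂ e₂ k₂), IsPerm w := by
  rintro _ ⟨L, hL, R, hR, rfl⟩
  exact isPerm_join hL.1 hR.1

theorem isPerm_of_mem_joinCross {c₁ c₂ : ℕ∞} {b₁ b₂ e₁ e₂ : Bool} {k₁ k₂ : ℕ} :
    ∀ w ∈ Set.image2 joinCross (cls c₁ b₁ e₁ k₁) (cls c₂ b₂ e₂ k₂ \ {[]}), IsPerm w := by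
  rintro _ ⟨L, hL, R, hR, rfl⟩
  exact isPerm_joinCross hL.1 hR.1.1 hR.2

theorem nil_mem_cls {b e : Bool} {k : ℕ} : [] ∈ cls 0 b e k ↔ e = false ∧ 1 ≤ k := by
  cases e <;> simp [cls, IsPerm.nil, Zig, noInc_nil]

theorem singleton_mem_cls {b e : Bool} {k : ℕ} : [0] ∈ cls 0 b e k ↔ e = true ∧ 2 ≤ k := by
  cases e <;> simp [cls, IsPerm, Zig, noInc_singleton, occ_singleton]

theorem join_mem_cls {L R : List ℕ} (hL : IsPerm L) (hR : IsPerm R) {c : ℕ∞} {b e : Bool} {k : ℕ}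
    (h : L ≠ [] ∨ R ≠ [] ∨ b = false) :
    join L R ∈ cls c b e k ↔ (occ L).encard + (occ R).encard = c ∧
      ((Zig b L ∧ odd L = b) ∧ NoInc (k - 1) L) ∧
        (Zig true R ∧ odd R = (b == e)) ∧ NoInc k R := by
  simp only [cls, Set.mem_ofPred_eq, isPerm_join hL hR, encard_occ_join hL hR, zig_join hL hR h,
    noInc_join hL hR, true_and]
  tauto

theorem joinCross_mem_cls {L R : List ℕ} (hL : IsPerm L) (hR : IsPerm R) (h0 : R ≠ []) {c : ℕ∞}
    {b e : Bool} {k : ℕ} :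
    joinCross L R ∈ cls c b e k ↔ (occ L).encard + (occ R).encard + 1 = c ∧ 3 ≤ k ∧
      ((Zig b L ∧ odd L = !b) ∧ NoInc (k - 1) L) ∧
        (Zig true R ∧ odd R = (b == e)) ∧ NoInc k R := by
  simp only [cls, Set.mem_ofPred_eq, isPerm_joinCross hL hR h0, encard_occ_joinCross hL hR h0,
    zig_joinCross hL hR, noInc_joinCross hL hR h0, true_and]
  tauto

theorem ne_of_odd {L R : List ℕ} {b : Bool} (h : odd L = b) : L ≠ [] ∨ R ≠ [] ∨ b = false := by
  by_cases h0 : L = []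
  · subst h0
    exact Or.inr (Or.inr h.symm)
  · exact Or.inl h0

theorem join_nil_nil : join [] [] = [0] := rfl

theorem join_ne_nil (L R : List ℕ) : join L R ≠ [] := by simp [join]

/-- The one-letter word needs its own term only for `b = true`, where the left part must have odd
length; for `b = false` it is already `join [] []`. -/
theorem cls_zero (b e : Bool) (k : ℕ) :
    cls 0 b e k = {w | w = [] ∧ e = false ∧ 1 ≤ k} ∪ {w | w = [0] ∧ b = true ∧ e = true ∧ 2 ≤ k} ∪
      Set.image2 join (cls 0 b b (k - 1)) (cls 0 true (b == e) k) := by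
  ext w
  simp only [Set.mem_union, Set.mem_image2, Set.mem_ofPred_eq]
  constructor
  · intro hw
    by_cases h0 : w = []
    · subst h0
      exact Or.inl (Or.inl ⟨rfl, nil_mem_cls.1 hw⟩)
    rcases exists_join_or_joinCross hw.1 h0 (by rw [hw.2.1]; simp) with
      ⟨L, R, hL, hR, rfl⟩ | ⟨L, R, hL, hR, hR0, rfl⟩
    · by_cases h : L ≠ [] ∨ R ≠ [] ∨ b = false
      · rw [join_mem_cls hL hR h, add_eq_zero] at hw
        exact Or.inr ⟨L, ⟨hL, hw.1.1, hw.2.1⟩, R, ⟨hR, hw.1.2, hw.2.2⟩, rfl⟩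
      · push Not at h
        obtain ⟨rfl, rfl, h⟩ := h
        rw [join_nil_nil] at hw
        exact Or.inl (Or.inr ⟨rfl, by simpa using h, singleton_mem_cls.1 hw⟩)
    · have := hw.2.1
      rw [encard_occ_joinCross hL hR hR0] at this
      simp at this
  · rintro ((⟨rfl, h⟩ | ⟨rfl, -, h⟩) | ⟨L, hL, R, hR, rfl⟩)
    · exact nil_mem_cls.2 h
    · exact singleton_mem_cls.2 h
    · rw [join_mem_cls hL.1 hR.1 (ne_of_odd hL.2.2.1.2), hL.2.1, hR.2.1]
      exact ⟨by simp, hL.2.2, hR.2.2⟩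

/-- The single occurrence lies in the left part, in the right part, or uses the largest letter. -/
theorem cls_one (b e : Bool) {k : ℕ} (hk : 3 ≤ k) :
    cls 1 b e k = Set.image2 join (cls 1 b b (k - 1)) (cls 0 true (b == e) k) ∪
      Set.image2 join (cls 0 b b (k - 1)) (cls 1 true (b == e) k) ∪
      Set.image2 joinCross (cls 0 b (!b) (k - 1)) (cls 0 true (b == e) k \ {[]}) := by
  ext w
  simp only [Set.mem_union, Set.mem_image2]
  constructor
  · intro hw
    have h0 : w ≠ [] := by
      rintro rfl
      have := hw.2.1
      simp at this
    rcases exists_join_or_joinCross hw.1 h0 (by rw [hw.2.1]) with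
      ⟨L, R, hL, hR, rfl⟩ | ⟨L, R, hL, hR, hR0, rfl⟩
    · by_cases h : L ≠ [] ∨ R ≠ [] ∨ b = false
      · rw [join_mem_cls hL hR h] at hw
        left
        by_cases hL0 : (occ L).encard = 0
        · rw [hL0, zero_add] at hw
          exact Or.inr ⟨L, ⟨hL, hL0, hw.2.1⟩, R, ⟨hR, hw.1, hw.2.2⟩, rfl⟩
        · have h1 : 1 ≤ (occ L).encard := Order.one_le_iff_pos.2 (pos_iff_ne_zero.2 hL0)
          have h2 : (occ L).encard = 1 := le_antisymm (hw.1 ▸ le_self_add) h1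
          have h3 : (occ R).encard = 0 := by
            have h4 := hw.1
            rw [h2] at h4
            exact WithTop.add_left_cancel (by simp : (1 : ℕ∞) ≠ ⊤) (h4.trans (add_zero 1).symm)
          exact Or.inl ⟨L, ⟨hL, h2, hw.2.1⟩, R, ⟨hR, h3, hw.2.2⟩, rfl⟩
      · push Not at h
        obtain ⟨rfl, rfl, h⟩ := h
        have := hw.2.1
        rw [join_nil_nil, occ_singleton] at this
        simp at this
    · rw [joinCross_mem_cls hL hR hR0] at hw
      have h1 : (occ L).encard + (occ R).encard = 0 :=
        WithTop.add_right_cancel (by simp : (1 : ℕ∞) ≠ ⊤) (hw.1.trans (zero_add 1).symm)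
      rw [add_eq_zero] at h1
      exact Or.inr ⟨L, ⟨hL, h1.1, hw.2.2.1⟩, R, ⟨⟨hR, h1.2, hw.2.2.2⟩, hR0⟩, rfl⟩
  · rintro ((⟨L, hL, R, hR, rfl⟩ | ⟨L, hL, R, hR, rfl⟩) | ⟨L, hL, R, ⟨hR, hR0⟩, rfl⟩)
    · rw [join_mem_cls hL.1 hR.1 (ne_of_odd hL.2.2.1.2), hL.2.1, hR.2.1]
      exact ⟨by simp, hL.2.2, hR.2.2⟩
    · rw [join_mem_cls hL.1 hR.1 (ne_of_odd hL.2.2.1.2), hL.2.1, hR.2.1]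
      exact ⟨by simp, hL.2.2, hR.2.2⟩
    · rw [joinCross_mem_cls hL.1 hR.1 hR0, hL.2.1, hR.2.1]
      exact ⟨by simp, hk, hL.2.2, hR.2.2⟩

/-- The 1 and the 2 of an occurrence form an increasing pair. This starts the inductions at `k = 2`.
-/
theorem cls_one_eq_empty (b e : Bool) {k : ℕ} (hk : k ≤ 2) : cls 1 b e k = ∅ := by
  ext w
  simp only [Set.mem_empty_iff_false, iff_false]
  rintro ⟨-, h, -, h1⟩
  obtain ⟨⟨x, y, z⟩, ht⟩ := Set.encard_eq_one.1 h
  obtain ⟨h2, h3, h4⟩ : (x, y, z) ∈ occ w := by rw [ht]; rfl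
  have h5 : [x, z] <+ w := Sublist.trans (by simp) h2
  have := h1 _ h5 (by simpa using h3)
  simp at this
  omega

/-- The generating function of `cls`. -/
noncomputable def clsGF (c : ℕ∞) (b e : Bool) (k : ℕ) : PowerSeries ℚ := genFun (cls c b e k)

theorem genFun_setOf_eq (w : List ℕ) (p : Prop) [Decidable p] :
    genFun {v | v = w ∧ p} = if p then X ^ w.length else 0 := by
  split_ifs with h
  · simp only [h, and_true]
    exact genFun_singleton w
  · simp only [h, and_false]
    exact genFun_empty

theorem clsGF_zero (b e : Bool) (k : ℕ) :
    clsGF 0 b e k = (if e = false ∧ 1 ≤ k then 1 else 0) +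
      (if b = true ∧ e = true ∧ 2 ≤ k then X else 0) +
      X * (clsGF 0 b b (k - 1) * clsGF 0 true (b == e) k) := by
  have hnil : ∀ w ∈ {w : List ℕ | w = [] ∧ e = false ∧ 1 ≤ k}, IsPerm w := by
    rintro _ ⟨rfl, -⟩
    exact IsPerm.nil
  have hone : ∀ w ∈ {w : List ℕ | w = [0] ∧ b = true ∧ e = true ∧ 2 ≤ k}, IsPerm w := by
    rintro _ ⟨rfl, -⟩
    simp [IsPerm]
  unfold clsGF
  conv_lhs => rw [cls_zero]
  rw [genFun_union (fun w hw => hw.elim (hnil w) (hone w)) isPerm_of_mem_join,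
    genFun_union hnil hone, genFun_join, genFun_setOf_eq, genFun_setOf_eq]
  · simp
  · rw [Set.disjoint_left]
    rintro _ ⟨rfl, -⟩ ⟨h, -⟩
    simp at h
  · rw [Set.disjoint_left]
    rintro _ (⟨rfl, -⟩ | ⟨rfl, rfl, -⟩) ⟨L, hL, R, hR, h⟩
    · exact join_ne_nil _ _ h
    · have h1 : L.length = 0 := by
        have := congrArg List.length h
        simp at this
        simp [this.1]
      have h2 := hL.2.2.1.2
      rw [List.length_eq_zero_iff.1 h1] at h2
      simp at h2

theorem genFun_cls_diff_nil (b e : Bool) (k : ℕ) :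
    genFun (cls 0 b e k \ {[]}) = clsGF 0 b e k - if e = false ∧ 1 ≤ k then 1 else 0 := by
  have h : cls 0 b e k = {w | w = [] ∧ e = false ∧ 1 ≤ k} ∪ (cls 0 b e k \ {[]}) := by
    ext w
    simp only [Set.mem_union, Set.mem_sdiff, Set.mem_ofPred_eq, Set.mem_singleton_iff]
    by_cases h0 : w = []
    · subst h0
      simp [nil_mem_cls]
    · simp [h0]
  have h2 : genFun (cls 0 b e k) = (if e = false ∧ 1 ≤ k then X ^ 0 else 0) +
      genFun (cls 0 b e k \ {[]}) := by
    conv_lhs => rw [h]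
    rw [genFun_union _ (fun w hw => hw.1.1), genFun_setOf_eq]
    · rfl
    · rw [Set.disjoint_left]
      rintro _ ⟨rfl, -⟩ h
      exact h.2 rfl
    · rintro _ ⟨rfl, -⟩
      exact IsPerm.nil
  rw [clsGF, h2]
  simp

theorem clsGF_one (b e : Bool) {k : ℕ} (hk : 3 ≤ k) :
    clsGF 1 b e k = X * (clsGF 1 b b (k - 1) * clsGF 0 true (b == e) k) +
      X * (clsGF 0 b b (k - 1) * clsGF 1 true (b == e) k) +
      X ^ 2 * (clsGF 0 b (!b) (k - 1) *
        (clsGF 0 true (b == e) k - if (b == e) = false then 1 else 0)) := by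
  have h3 : genFun (Set.image2 joinCross (cls 0 b (!b) (k - 1)) (cls 0 true (b == e) k \ {[]})) =
      X ^ 2 * (clsGF 0 b (!b) (k - 1) *
        (clsGF 0 true (b == e) k - if (b == e) = false then 1 else 0)) := by
    rw [genFun_image2 (m := 2) (fun w hw => hw.1) (fun w hw => hw.1.1)
      (fun L R => length_joinCross L R), genFun_cls_diff_nil]
    · simp only [clsGF, show 1 ≤ k by omega, and_true]
    · intro L hL R hR L' _ R' _ h
      exact joinCross_injective hL.1 hR.1.1 h
  unfold clsGF at *
  conv_lhs => rw [cls_one b e hk]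
  rw [genFun_union (fun w hw => hw.elim (isPerm_of_mem_join w) (isPerm_of_mem_join w))
    isPerm_of_mem_joinCross, genFun_union isPerm_of_mem_join isPerm_of_mem_join, genFun_join,
    genFun_join, h3]
  · rw [Set.disjoint_left]
    rintro _ ⟨L, hL, R, hR, rfl⟩ ⟨L', hL', R', hR', h⟩
    obtain ⟨rfl, rfl⟩ := join_injective hL'.1 hR'.1 h
    have := hL.2.1.symm.trans hL'.2.1
    simp at this
  · rw [Set.disjoint_left]
    rintro _ (⟨L, hL, R, hR, rfl⟩ | ⟨L, hL, R, hR, rfl⟩) ⟨L', hL', R', hR', h⟩ <;>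
      exact join_ne_joinCross hL.1 hR.1 hR'.1.1 hR'.2 h.symm

theorem clsGF_one_eq_zero (b e : Bool) {k : ℕ} (hk : k ≤ 2) : clsGF 1 b e k = 0 := by
  rw [clsGF, cls_one_eq_empty b e hk, genFun_empty]

end PermList

/-! ### Translation between permutations of `Fin n` and words. -/

namespace PermList

open List AltPerm
open Equiv (Perm)

/-- The one-line notation of a permutation. -/
def word {n : ℕ} (π : Perm (Fin n)) : List ℕ := List.ofFn fun i => (π i : ℕ)

@[simp] theorem length_word {n : ℕ} (π : Perm (Fin n)) : (word π).length = n := by simp [word]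

theorem word_injective {n : ℕ} : Function.Injective (word (n := n)) := by
  intro π σ h
  ext i
  exact congrFun (List.ofFn_injective h) i

theorem isPerm_word {n : ℕ} (π : Perm (Fin n)) : IsPerm (word π) := by
  refine ⟨?_, ?_⟩
  · exact List.nodup_ofFn.2 (Fin.val_injective.comp π.injective)
  · intro v hv
    obtain ⟨i, rfl⟩ := List.mem_ofFn.1 hv
    rw [length_word]
    exact (π i).2

theorem exists_word_eq {w : List ℕ} (hw : IsPerm w) : ∃ π : Perm (Fin w.length), word π = w := by
  let f : Fin w.length → Fin w.length := fun i => ⟨w.get i, hw.2 _ (List.get_mem w i)⟩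
  have hf : Function.Injective f := by
    intro i j h
    exact hw.1.injective_get (Fin.mk.inj_iff.1 h)
  refine ⟨Equiv.ofBijective f (Finite.injective_iff_bijective.1 hf), ?_⟩
  change List.ofFn (fun i => w.get i) = w
  exact List.ofFn_get w

theorem sublist_ofFn_iff {n : ℕ} {g : Fin n → ℕ} {l : List ℕ} :
    l <+ List.ofFn g ↔ ∃ f : Fin l.length ↪o Fin n, ∀ i, l.get i = g (f i) := by
  rw [sublist_iff_exists_fin_orderEmbedding_get_eq]
  have hn : (List.ofFn g).length = n := List.length_ofFn
  constructor
  · rintro ⟨f, hf⟩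
    refine ⟨f.trans (Fin.castOrderIso hn).toOrderEmbedding, fun i => ?_⟩
    rw [hf, List.get_ofFn]
    rfl
  · rintro ⟨f, hf⟩
    refine ⟨f.trans (Fin.castOrderIso hn.symm).toOrderEmbedding, fun i => ?_⟩
    rw [hf, List.get_ofFn]
    rfl

theorem noInc_word_iff {n : ℕ} (π : Perm (Fin n)) (k : ℕ) :
    NoInc k (word π) ↔ Avoids (patternInc k) π := by
  constructor
  · rintro h ⟨f, hf⟩
    have hs : List.ofFn (fun i : Fin k => (π (f i) : ℕ)) <+ word π := by
      refine sublist_ofFn_iff.2 ⟨(Fin.castOrderIso List.length_ofFn).toOrderEmbedding.trans f, ?_⟩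
      intro i
      rw [List.get_ofFn]
      rfl
    have := h _ hs (List.pairwise_ofFn.2 fun i j hij => (hf i j).2 hij)
    simp at this
  · intro h l hl hp
    by_contra! hk
    -- A longer increasing subsequence is cut to its first `k` terms, giving an occurrence of the
    -- pattern itself.
    have hlen : (l.take k).length = k := by simp [hk]
    have hp' := hp.sublist (take_sublist k l)
    obtain ⟨f, hf⟩ := sublist_ofFn_iff.1 ((take_sublist k l).trans hl)
    generalize l.take k = l' at *
    subst hlen
    have hm : StrictMono fun i => π (f i) := by
      intro i j hij
      have := List.pairwise_iff_get.1 hp' i j hij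
      rw [hf, hf] at this
      exact this
    exact h ⟨f, fun a b => hm.lt_iff_lt⟩

theorem isOccurrence_pattern132_iff {n : ℕ} (π : Perm (Fin n)) (f : Fin 3 ↪o Fin n) :
    IsOccurrence pattern132 π f ↔ π (f 0) < π (f 2) ∧ π (f 2) < π (f 1) := by
  have h0 : pattern132 0 = 0 := by decide
  have h1 : pattern132 1 = 2 := by decide
  have h2 : pattern132 2 = 1 := by decide
  constructor
  · intro h
    exact ⟨(h 0 2).2 (by rw [h0, h2]; decide), (h 2 1).2 (by rw [h1, h2]; decide)⟩
  · rintro ⟨h3, h4⟩ a b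
    have h5 := h3.trans h4
    fin_cases a <;> fin_cases b <;>
      simp [h0, h1, h2, h3, h4, h5, h3.le, h4.le, h5.le]

theorem encard_occ_word_eq_one_iff {n : ℕ} (π : Perm (Fin n)) :
    (occ (word π)).encard = 1 ↔ ContainsOnce pattern132 π := by
  let F : (Fin 3 ↪o Fin n) → ℕ × ℕ × ℕ := fun f => (π (f 0), π (f 1), π (f 2))
  have hF : Function.Injective F := by
    intro f g h
    simp only [F, Prod.mk.injEq] at h
    ext i
    have h0 := π.injective (Fin.val_injective h.1)
    have h1 := π.injective (Fin.val_injective h.2.1)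
    have h2 := π.injective (Fin.val_injective h.2.2)
    fin_cases i
    · exact congrArg _ h0
    · exact congrArg _ h1
    · exact congrArg _ h2
  have himg : occ (word π) = F '' {f | IsOccurrence pattern132 π f} := by
    ext ⟨a, b, c⟩
    rw [mem_occ, word, sublist_ofFn_iff]
    simp only [Set.mem_image, Set.mem_ofPred_eq, isOccurrence_pattern132_iff]
    constructor
    · rintro ⟨⟨f, hf⟩, h1, h2⟩
      have e0 : a = π (f 0) := hf 0
      have e1 : b = π (f 1) := hf 1
      have e2 : c = π (f 2) := hf 2
      refine ⟨f, ⟨?_, ?_⟩, Prod.ext e0.symm (Prod.ext e1.symm e2.symm)⟩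
      · rw [e0, e2] at h1
        exact h1
      · rw [e1, e2] at h2
        exact h2
    · rintro ⟨f, ⟨h1, h2⟩, h⟩
      simp only [F, Prod.mk.injEq] at h
      obtain ⟨rfl, rfl, rfl⟩ := h
      refine ⟨⟨f, fun i => ?_⟩, h1, h2⟩
      change Fin 3 at i
      fin_cases i <;> rfl
  rw [himg, hF.encard_image, Set.encard_eq_one]
  refine exists_congr fun f => ?_
  rw [Set.eq_singleton_iff_unique_mem]
  rfl

/-- This makes the conventions for lengths `0` and `1`, where the four types and `Zig` disagree,
irrelevant. -/
theorem three_le_of_containsOnce {n : ℕ} {π : Perm (Fin n)} (h : ContainsOnce pattern132 π) :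
    3 ≤ n := by
  obtain ⟨f, -⟩ := h
  simpa using Fintype.card_le_of_injective f f.injective

theorem isDescent_iff {n : ℕ} (π : Perm (Fin n)) {i : ℕ} (h : i + 1 < n) :
    IsDescent π i ↔ ¬ IsRise π i := by
  have hne : π ⟨i, Nat.lt_of_succ_lt h⟩ ≠ π ⟨i + 1, h⟩ := fun h => by
    simpa using π.injective h
  constructor
  · rintro ⟨_, h1⟩ ⟨_, h2⟩
    exact lt_asymm h1 h2
  · intro h1
    exact ⟨h, lt_of_le_of_ne (not_lt.1 fun h2 => h1 ⟨h, h2⟩) hne.symm⟩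

theorem zig_iff (w : List ℕ) : ∀ b, Zig b w ↔ ∀ i, ∀ h : i + 1 < w.length,
    if i.bodd = b then w[i + 1] < w[i] else w[i] < w[i + 1] := by
  induction w with
  | nil => simp [Zig]
  | cons a t ih =>
    cases t with
    | nil => simp [Zig]
    | cons c t =>
      intro b
      have h1 : Zig b (a :: c :: t) ↔
          (if false = b then c < a else a < c) ∧ Zig (!b) (c :: t) := by
        cases b <;> simp [Zig]
      have hb : ∀ i : ℕ, (i + 1).bodd = b ↔ i.bodd = !b := fun i => by simp [Nat.bodd_succ]
      rw [h1, ih]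
      constructor
      · rintro ⟨h2, h3⟩ i hi
        cases i with
        | zero => exact h2
        | succ i =>
          exact (if_congr (hb i) rfl rfl).mpr (h3 i (by simpa using hi))
      · intro h2
        refine ⟨h2 0 (by simp), fun i hi => ?_⟩
        exact (if_congr (hb i) rfl rfl).mp (h2 (i + 1) (by simpa using hi))

theorem zig_word_iff {n : ℕ} (π : Perm (Fin n)) (b : Bool) :
    Zig b (word π) ↔ ∀ i, i + 1 < n → (IsRise π i ↔ i.bodd ≠ b) := by
  have hiff : ∀ i, ∀ h : i + 1 < n,
      ((IsRise π i ↔ (word π)[i]'(by simp; omega) < (word π)[i + 1]'(by simpa using h)) ∧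
      (IsDescent π i ↔ (word π)[i + 1]'(by simpa using h) < (word π)[i]'(by simp; omega))) := by
    intro i h
    simp [IsRise, IsDescent, word, h]
  rw [zig_iff]
  constructor
  · intro h i hi
    have := h i (by simpa using hi)
    split_ifs at this with h1
    · rw [← (hiff i hi).2, isDescent_iff π hi] at this
      simp [this, h1]
    · rw [← (hiff i hi).1] at this
      simp [this, h1]
  · intro h i hi
    have hi : i + 1 < n := by simpa using hi
    have := h i hi
    split_ifs with h1
    · rw [← (hiff i hi).2, isDescent_iff π hi, this]
      simp [h1]
    · rw [← (hiff i hi).1, this]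
      exact h1

theorem zig_word_iff_inTurn {n : ℕ} (hn : 3 ≤ n) (π : Perm (Fin n)) (b : Bool) :
    Zig b (word π) ↔ (IsRise π 0 ↔ b = true) ∧ InTurn π := by
  rw [zig_word_iff]
  constructor
  · intro h
    refine ⟨?_, fun i hi => ?_⟩
    · rw [h 0 (by omega)]
      cases b <;> simp
    · rw [isDescent_iff π (by omega), h i (by omega), h (i + 1) (by omega), Nat.bodd_succ]
      cases i.bodd <;> cases b <;> simp
  · rintro ⟨h0, h⟩ i
    induction i with
    | zero =>
      intro _
      rw [h0]
      cases b <;> simp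
    | succ i ih =>
      intro hi
      have h1 := ih (by omega)
      have h2 := h i (by omega)
      rw [isDescent_iff π (by omega), h1] at h2
      rw [Nat.bodd_succ]
      revert h2
      cases i.bodd <;> cases b <;> simp

theorem odd_word {n : ℕ} (π : Perm (Fin n)) : odd (word π) = n.bodd := by simp [odd]

theorem isRise_last_iff {n : ℕ} (hn : 3 ≤ n) {π : Perm (Fin n)} {b : Bool} (h : Zig b (word π)) :
    IsRise π (n - 2) ↔ odd (word π) ≠ b := by
  rw [(zig_word_iff π b).1 h _ (by omega), odd_word]
  obtain ⟨m, rfl⟩ := Nat.exists_eq_add_of_le' (show 2 ≤ n by omega)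
  simp [Nat.bodd_succ]

theorem isDescent_last_iff {n : ℕ} (hn : 3 ≤ n) {π : Perm (Fin n)} {b : Bool}
    (h : Zig b (word π)) : IsDescent π (n - 2) ↔ odd (word π) = b := by
  rw [isDescent_iff π (by omega), isRise_last_iff hn h, not_not]

theorem isUpDown_iff {n : ℕ} (hn : 3 ≤ n) (π : Perm (Fin n)) :
    IsUpDown π ↔ Zig true (word π) ∧ odd (word π) = true := by
  have h1 := zig_word_iff_inTurn hn π true
  have h2 := @isDescent_last_iff n hn π true
  unfold IsUpDown
  tauto

theorem isUpUp_iff {n : ℕ} (hn : 3 ≤ n) (π : Perm (Fin n)) :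
    IsUpUp π ↔ Zig true (word π) ∧ odd (word π) = false := by
  have h1 := zig_word_iff_inTurn hn π true
  have h2 := @isRise_last_iff n hn π true
  unfold IsUpUp
  rw [← Bool.not_eq_true]
  tauto

theorem isDownDown_iff {n : ℕ} (hn : 3 ≤ n) (π : Perm (Fin n)) :
    IsDownDown π ↔ Zig false (word π) ∧ odd (word π) = false := by
  have h1 := zig_word_iff_inTurn hn π false
  have h2 := @isDescent_last_iff n hn π false
  have h3 := isDescent_iff π (i := 0) (by omega)
  simp only [Bool.false_eq_true, iff_false] at h1
  unfold IsDownDown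
  tauto

theorem isDownUp_iff {n : ℕ} (hn : 3 ≤ n) (π : Perm (Fin n)) :
    IsDownUp π ↔ Zig false (word π) ∧ odd (word π) = true := by
  have h1 := zig_word_iff_inTurn hn π false
  have h2 := @isRise_last_iff n hn π false
  have h3 := isDescent_iff π (i := 0) (by omega)
  simp only [Bool.false_eq_true, iff_false] at h1
  simp only [ne_eq, Bool.not_eq_false] at h2
  unfold IsDownUp
  tauto

theorem isAlternating_iff {n : ℕ} (π : Perm (Fin n)) : IsAlternating π ↔ Zig true (word π) := by
  rw [zig_word_iff]
  refine forall₂_congr fun i hi => ?_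
  rw [isDescent_iff π hi]
  rcases Nat.even_or_odd i with h | h
  · have h1 : i.bodd = false := by simpa [Nat.even_iff, Nat.mod_two_of_bodd] using h
    simp [h, h1, Nat.not_odd_iff_even.2 h]
  · have h1 : i.bodd = true := by simpa [Nat.odd_iff, Nat.mod_two_of_bodd] using h
    simp [h, h1, Nat.not_even_iff_odd.2 h]

theorem gf_eq_genFun {P : ∀ n : ℕ, Perm (Fin n) → Prop} {k : ℕ} {C : Set (List ℕ)}
    (hC : ∀ w ∈ C, IsPerm w)
    (h : ∀ n, ∀ π : Perm (Fin n),
      P n π ∧ ContainsOnce pattern132 π ∧ Avoids (patternInc k) π ↔ word π ∈ C) :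
    gf P k = (genFun C : LaurentSeries ℚ) := by
  unfold gf genFun
  congr 2
  ext n
  rw [← Set.ncard_image_of_injective _ word_injective]
  congr 2
  ext w
  simp only [Set.mem_image, Set.mem_ofPred_eq, h, slice]
  constructor
  · rintro ⟨π, hπ, rfl⟩
    exact ⟨hπ, length_word π⟩
  · rintro ⟨hw, rfl⟩
    obtain ⟨π, hπ⟩ := exists_word_eq (hC w hw)
    exact ⟨π, by rwa [hπ], hπ⟩

theorem gf_eq_clsGF {P : ∀ n : ℕ, Perm (Fin n) → Prop} (k : ℕ) {b e : Bool}
    (h : ∀ n, 3 ≤ n → ∀ π : Perm (Fin n), P n π ↔ Zig b (word π) ∧ odd (word π) = e) :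
    gf P k = (clsGF 1 b e k : LaurentSeries ℚ) := by
  refine gf_eq_genFun (fun w hw => hw.1) fun n π => ?_
  simp only [cls, Set.mem_ofPred_eq, isPerm_word, true_and, encard_occ_word_eq_one_iff,
    noInc_word_iff]
  have h1 := @three_le_of_containsOnce n π
  have h2 := fun hn => h n hn π
  tauto

theorem UD1_eq (k : ℕ) : UD1 k = (clsGF 1 true true k : LaurentSeries ℚ) :=
  gf_eq_clsGF k fun _ hn => isUpDown_iff hn

theorem UU1_eq (k : ℕ) : UU1 k = (clsGF 1 true false k : LaurentSeries ℚ) :=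
  gf_eq_clsGF k fun _ hn => isUpUp_iff hn

theorem DD1_eq (k : ℕ) : DD1 k = (clsGF 1 false false k : LaurentSeries ℚ) :=
  gf_eq_clsGF k fun _ hn => isDownDown_iff hn

theorem DU1_eq (k : ℕ) : DU1 k = (clsGF 1 false true k : LaurentSeries ℚ) :=
  gf_eq_clsGF k fun _ hn => isDownUp_iff hn

/-- Alternating words starting with a rise split by the parity of their length. -/
theorem A1_eq (k : ℕ) : A1 k = UD1 k + UU1 k := by
  rw [UD1_eq, UU1_eq, ← PowerSeries.coe_add, clsGF, clsGF, ← genFun_union]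
  · refine gf_eq_genFun (fun w hw => hw.elim (fun h => h.1) (fun h => h.1)) fun n π => ?_
    simp only [cls, Set.mem_union, Set.mem_ofPred_eq, isPerm_word, true_and,
      encard_occ_word_eq_one_iff, noInc_word_iff, isAlternating_iff]
    cases odd (word π) <;> simp <;> tauto
  · exact fun w hw => hw.1
  · exact fun w hw => hw.1
  · rw [Set.disjoint_left]
    intro w h1 h2
    have := h1.2.2.1.2.symm.trans h2.2.2.1.2
    simp at this

end PermList

/-! ### Chebyshev polynomials and the solution of the recurrences. -/

namespace PermList

open AltPerm

/-- Chebyshev polynomials of the second kind at `1 / (2x)`, with shifted index. -/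
noncomputable def V (n : ℕ) : LaurentSeries ℚ := AltPerm.U ((n : ℤ) - 1)

theorem x_ne_zero : AltPerm.x ≠ 0 := by
  unfold AltPerm.x
  rw [Ne, map_eq_zero_iff _ HahnSeries.ofPowerSeries_injective]
  exact PowerSeries.X_ne_zero

theorem U_rec (r : ℤ) :
    AltPerm.x * AltPerm.U (r + 2) = AltPerm.U (r + 1) - AltPerm.x * AltPerm.U r := by
  have hx := x_ne_zero
  unfold AltPerm.U
  rw [Polynomial.Chebyshev.U_add_two]
  simp only [map_sub, map_mul, Polynomial.aeval_X, map_ofNat]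
  have h2 : (2 : LaurentSeries ℚ) ≠ 0 := by
    rw [← map_ofNat (algebraMap ℚ (LaurentSeries ℚ)) 2]
    exact (map_ne_zero _).2 two_ne_zero
  field_simp

theorem V_zero : V 0 = 0 := by simp [V, AltPerm.U]

theorem V_one : V 1 = 1 := by simp [V, AltPerm.U]

theorem V_rec (n : ℕ) : AltPerm.x * V (n + 2) = V (n + 1) - AltPerm.x * V n := by
  have := U_rec ((n : ℤ) - 1)
  unfold V
  push_cast
  convert this using 3 <;> ring_nf

/-- The leading term of `V (n + 1)` at `x = 0` is `x ^ (-n)`; clearing it gives a unit power series,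
hence nonvanishing. -/
theorem V_succ_eq_coe (n : ℕ) : ∃ f : PowerSeries ℚ, PowerSeries.constantCoeff f = 1 ∧
    AltPerm.x ^ n * V (n + 1) = (f : LaurentSeries ℚ) := by
  induction n using Nat.twoStepInduction with
  | zero => exact ⟨1, by simp, by simp [V_one]⟩
  | one =>
    refine ⟨1, by simp, ?_⟩
    rw [pow_one, V_rec 0, V_one, V_zero]
    simp
  | more n ih₁ ih₂ =>
    obtain ⟨f, hf, h₁⟩ := ih₁
    obtain ⟨g, hg, h₂⟩ := ih₂
    refine ⟨g - PowerSeries.X ^ 2 * f, by simp [hf, hg], ?_⟩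
    have := V_rec (n + 1)
    rw [PowerSeries.coe_sub, PowerSeries.coe_mul, PowerSeries.coe_pow, ← h₁, ← h₂]
    change _ = _ - AltPerm.x ^ 2 * _
    linear_combination AltPerm.x ^ (n + 1) * this

theorem V_succ_ne_zero (n : ℕ) : V (n + 1) ≠ 0 := by
  intro h
  obtain ⟨f, hf, h₁⟩ := V_succ_eq_coe n
  rw [h, mul_zero, eq_comm, map_eq_zero_iff _ HahnSeries.ofPowerSeries_injective] at h₁
  rw [h₁] at hf
  simp at hf

/-- `clsGF` as a Laurent series. -/
noncomputable def F (c : ℕ∞) (b e : Bool) (k : ℕ) : LaurentSeries ℚ :=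
  (clsGF c b e k : LaurentSeries ℚ)

theorem F_zero (b e : Bool) (k : ℕ) :
    F 0 b e k = (if e = false ∧ 1 ≤ k then 1 else 0) +
      (if b = true ∧ e = true ∧ 2 ≤ k then AltPerm.x else 0) +
      AltPerm.x * (F 0 b b (k - 1) * F 0 true (b == e) k) := by
  unfold F
  conv_lhs => rw [clsGF_zero]
  rw [PowerSeries.coe_add, PowerSeries.coe_add, PowerSeries.coe_mul, PowerSeries.coe_mul]
  congr 2 <;> split_ifs <;> simp [AltPerm.x]

theorem F_one (b e : Bool) {k : ℕ} (hk : 3 ≤ k) :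
    F 1 b e k = AltPerm.x * (F 1 b b (k - 1) * F 0 true (b == e) k) +
      AltPerm.x * (F 0 b b (k - 1) * F 1 true (b == e) k) +
      AltPerm.x ^ 2 * (F 0 b (!b) (k - 1) *
        (F 0 true (b == e) k - if (b == e) = false then 1 else 0)) := by
  unfold F
  conv_lhs => rw [clsGF_one b e hk]
  simp only [PowerSeries.coe_add, PowerSeries.coe_mul, PowerSeries.coe_pow, PowerSeries.coe_sub]
  congr 4
  split_ifs <;> simp

theorem F_one_two (b e : Bool) : F 1 b e 2 = 0 := by
  rw [F, clsGF_one_eq_zero b e le_rfl, PowerSeries.coe_zero]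

theorem F_eq_zero (c : ℕ∞) (b e : Bool) : F c b e 0 = 0 := by
  have : cls c b e 0 = ∅ := by
    ext w
    simp only [Set.mem_empty_iff_false, iff_false]
    exact fun h => not_noInc_zero w h.2.2.2
  rw [F, clsGF, this, genFun_empty, PowerSeries.coe_zero]

/-- The recurrence gives `P_k (1 - x P_{k-1}) = x` for `k ≥ 2`; with `P_{k-1} = V n / V (n + 1)` the
bracket is `x V (n + 2) / V (n + 1)` by `V_rec`. -/
theorem F_true_true (n : ℕ) : F 0 true true (n + 1) = V n / V (n + 1) := by
  rw [eq_div_iff (V_succ_ne_zero n)]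
  induction n with
  | zero =>
    have h := F_zero true true 1
    simp [F_eq_zero] at h
    simp [h, V_zero]
  | succ n ih =>
    have h := F_zero true true (n + 2)
    simp at h
    have hV := V_rec n
    refine mul_left_cancel₀ x_ne_zero ?_
    linear_combination V (n + 1) * h + AltPerm.x * F 0 true true (n + 2) * ih +
      F 0 true true (n + 2) * hV

theorem F_true_false (n : ℕ) :
    F 0 true false (n + 2) = V (n + 1) / (AltPerm.x * V (n + 2)) := by
  have h := F_zero true false (n + 2)
  have hP := F_true_true n
  rw [eq_div_iff (V_succ_ne_zero n)] at hP
  rw [eq_div_iff (mul_ne_zero x_ne_zero (V_succ_ne_zero (n + 1)))]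
  simp at h
  linear_combination V (n + 1) * h + AltPerm.x * F 0 true false (n + 2) * hP +
      F 0 true false (n + 2) * V_rec n

/-- Here the unknown at `k` does not reappear on the right. Multiplied by the denominator, the
recurrence becomes additive, and the initial value survives as the power of `x`. -/
theorem F_false_false (n : ℕ) :
    F 0 false false (n + 1) = (AltPerm.x ^ (n + 1) + V n) / (AltPerm.x * V (n + 1)) := by
  rw [eq_div_iff (mul_ne_zero x_ne_zero (V_succ_ne_zero n))]
  induction n with
  | zero =>
    have h := F_zero false false 1
    simp [F_eq_zero] at h
    simp [h, V_zero, V_one]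
  | succ n ih =>
    have h := F_zero false false (n + 2)
    have hP := F_true_true (n + 1)
    rw [eq_div_iff (V_succ_ne_zero (n + 1))] at hP
    simp at h
    linear_combination AltPerm.x * V (n + 2) * h + AltPerm.x ^ 2 * F 0 false false (n + 1) * hP +
      AltPerm.x * ih + V_rec n

theorem F_false_true (n : ℕ) :
    F 0 false true (n + 2) =
      (AltPerm.x ^ (n + 1) + V n) / (AltPerm.x * V (n + 2)) := by
  have h := F_zero false true (n + 2)
  have h1 := V_succ_ne_zero n
  have h2 := V_succ_ne_zero (n + 1)
  have hx := x_ne_zero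
  simp only [Bool.true_eq_false, Bool.false_eq_true, false_and, if_false, zero_add,
    Nat.add_one_sub_one,
    show (false == true) = false from rfl, F_false_false, F_true_false] at h
  rw [h]
  field_simp

/-- Partial sums of products of consecutive Chebyshev polynomials. -/
noncomputable def sumV (n : ℕ) : LaurentSeries ℚ := ∑ j ∈ Finset.range n, V (j + 1) * V (j + 2)

theorem sumV_succ (n : ℕ) : sumV (n + 1) = sumV n + V (n + 1) * V (n + 2) :=
  Finset.sum_range_succ _ _

/-- Collecting the unknown gives again the factor `1 - x P_{k-1}`. After multiplication by the
squared Chebyshev factor, the step from `k - 1` to `k` adds only the crossing term, `V (n + 1) * V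
(n + 2)`. -/
theorem F_one_true_true (n : ℕ) : V (n + 2) ^ 2 * F 1 true true (n + 2) = sumV n := by
  induction n with
  | zero => simp [F_one_two, sumV]
  | succ n ih =>
    have h := F_one true true (k := n + 3) (by omega)
    have hx := x_ne_zero
    have h1 := V_succ_ne_zero n
    have h2 := V_succ_ne_zero (n + 1)
    have h3 := V_succ_ne_zero (n + 2)
    have hV := V_rec (n + 1)
    simp only [Nat.add_one_sub_one, beq_self_eq_true, Bool.not_true, Bool.true_eq_false,
      if_false, F_true_true, F_true_false, sub_zero] at h
    rw [sumV_succ, ← ih]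
    refine mul_left_cancel₀ hx ?_
    field_simp at h
    linear_combination h + F 1 true true (n + 3) * V (n + 3) * hV

/-- Removing the empty right part replaces `V (n + 2) / (x V (n + 3))` by `V (n + 1) / V (n + 3)`,
which produces the square on the right. -/
theorem F_one_true_false (n : ℕ) : AltPerm.x * V (n + 3) ^ 2 * F 1 true false (n + 3) =
    AltPerm.x * V (n + 1) ^ 2 + sumV n := by
  have h := F_one true false (k := n + 3) (by omega)
  have hx := x_ne_zero
  have h1 := V_succ_ne_zero n
  have h2 := V_succ_ne_zero (n + 1)
  have h3 := V_succ_ne_zero (n + 2)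
  have hV := V_rec (n + 1)
  simp only [Nat.add_one_sub_one, Bool.not_true,
    show (true == false) = false from rfl, if_true, F_true_true, F_true_false] at h
  rw [← F_one_true_true]
  field_simp at h
  linear_combination h + (F 1 true false (n + 3) * V (n + 3) - V (n + 1)) * hV

/-- The terms of the sum for the down-down permutations. -/
noncomputable def termDD (j : ℕ) : LaurentSeries ℚ :=
  (AltPerm.x ^ (j + 1) + V j) / (V (j + 2) * V (j + 1)) * sumV (j + 1) - AltPerm.x * V (j + 1)

/-- Multiplied by `V`, the recurrence reads "`x` times the previous value plus `termDD`"; unrolling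
it yields the powers of `x`. The base case holds because `termDD 0 = 0`. -/
theorem F_one_false_false (n : ℕ) : V (n + 2) * F 1 false false (n + 2) =
    ∑ i ∈ Finset.range (n + 1), AltPerm.x ^ i * termDD (n - i) := by
  induction n with
  | zero =>
    have hx := V_rec 0
    rw [V_zero, V_one] at hx
    have h2 := V_succ_ne_zero 1
    simp [F_one_two, termDD, sumV, V_zero, V_one]
    field_simp
    simp
  | succ n ih =>
    have h := F_one false false (k := n + 3) (by omega)
    have hx := x_ne_zero
    have h1 := V_succ_ne_zero n
    have h2 := V_succ_ne_zero (n + 1)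
    have h3 := V_succ_ne_zero (n + 2)
    have hV := V_rec (n + 1)
    have hV' := V_rec n
    have hp := F_one_true_true (n + 1)
    have hs := sumV_succ (n + 1)
    simp only [Nat.add_one_sub_one, Bool.not_false, beq_self_eq_true, Bool.true_eq_false, if_false,
      F_true_true, F_false_false, F_false_true, sub_zero] at h
    rw [Finset.sum_range_succ']
    simp only [Nat.add_sub_add_right, pow_succ', mul_assoc, ← Finset.mul_sum, ← ih, Nat.sub_zero,
      pow_zero, one_mul]
    -- The last summand of `sumV (n + 2)`, together with the subtracted `x V (n + 2)`, accounts for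
    -- the crossing term by `V_rec`.
    rw [termDD, hs, ← hp]
    change V (n + 3) * F 1 false false (n + 3) = _
    rw [h]
    field_simp
    linear_combination V (n + 2) * hV'

theorem F_one_false_true (n : ℕ) : F 1 false true (n + 3) =
    (AltPerm.x ^ (n + 2) + V (n + 1)) / V (n + 2) * F 1 true false (n + 3) +
      V (n + 2) / V (n + 3) * F 1 false false (n + 2) +
      AltPerm.x * V (n + 1) * (AltPerm.x ^ (n + 1) + V n) / (V (n + 2) * V (n + 3)) := by
  have h := F_one false true (k := n + 3) (by omega)
  have hx := x_ne_zero
  have h1 := V_succ_ne_zero n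
  have h2 := V_succ_ne_zero (n + 1)
  have h3 := V_succ_ne_zero (n + 2)
  have hV := V_rec (n + 1)
  simp only [Nat.add_one_sub_one, Bool.not_false,
    show (false == true) = false from rfl, if_true, F_false_false, F_false_true,
    F_true_false] at h
  rw [h]
  field_simp
  linear_combination -(AltPerm.x ^ (n + 1) + V n) * hV

end PermList

/-! ### The closed forms in the original indexing. -/

namespace PermList

open AltPerm

theorem U_eq_V {r : ℤ} {n : ℕ} (h : r + 1 = n) : AltPerm.U r = V n := by
  rw [V, ← h, add_sub_cancel_right]

theorem sum_U_eq_sumV (n : ℕ) :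
    ∑ j ∈ Finset.range n, AltPerm.U (j : ℤ) * AltPerm.U ((j : ℤ) + 1) = sumV n := by
  refine Finset.sum_congr rfl fun j _ => ?_
  rw [U_eq_V (n := j + 1) (by push_cast; ring), U_eq_V (n := j + 2) (by push_cast; ring)]

theorem sum_U_eq_sumV' (n : ℕ) :
    ∑ j ∈ Finset.range n, AltPerm.U ((j : ℤ) + 1) * AltPerm.U (j : ℤ) = sumV n := by
  rw [← sum_U_eq_sumV]
  exact Finset.sum_congr rfl fun j _ => mul_comm _ _

theorem UD1_eq_sumV (n : ℕ) : UD1 (n + 2) = 1 / V (n + 2) ^ 2 * sumV n := by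
  have h := V_succ_ne_zero (n + 1)
  rw [UD1_eq, ← F_one_true_true]
  field_simp
  rfl

theorem UU1_eq_sumV (n : ℕ) : UU1 (n + 3) =
    1 / (AltPerm.x * V (n + 3) ^ 2) * (AltPerm.x * V (n + 1) ^ 2 + sumV n) := by
  have h := V_succ_ne_zero (n + 2)
  have hx := x_ne_zero
  rw [UU1_eq, ← F_one_true_false]
  field_simp
  rfl

theorem A1_eq_sumV (n : ℕ) : A1 (n + 3) = 1 / (AltPerm.x * V (n + 3) ^ 2) *
    (AltPerm.x * V (n + 1) * (V (n + 1) + V (n + 2)) + (1 + AltPerm.x) * sumV n) := by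
  have h := V_succ_ne_zero (n + 2)
  have hx := x_ne_zero
  rw [A1_eq, UU1_eq_sumV, UD1_eq_sumV (n + 1), sumV_succ, show n + 1 + 2 = n + 3 from rfl]
  field_simp
  ring

theorem DD1_eq_sum (n : ℕ) : DD1 (n + 2) =
    1 / V (n + 2) * ∑ i ∈ Finset.range (n + 1), AltPerm.x ^ i * termDD (n - i) := by
  have h := V_succ_ne_zero (n + 1)
  rw [DD1_eq, ← F_one_false_false]
  field_simp
  rfl

end PermList

theorem theorem4p4 (k : ℕ) (hk : 3 ≤ k) :
    AltPerm.UD1 k =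
      1 / AltPerm.U ((k : ℤ) - 1) ^ 2 *
        ∑ j ∈ Finset.range (k - 2), AltPerm.U ((j : ℤ) + 1) * AltPerm.U (j : ℤ) ∧
    AltPerm.UU1 k =
      1 / (AltPerm.x * AltPerm.U ((k : ℤ) - 1) ^ 2) *
        (AltPerm.x * AltPerm.U ((k : ℤ) - 3) ^ 2 +
          ∑ j ∈ Finset.range (k - 3), AltPerm.U (j : ℤ) * AltPerm.U ((j : ℤ) + 1)) ∧
    AltPerm.DD1 k =
      1 / AltPerm.U ((k : ℤ) - 1) *
        ∑ i ∈ Finset.range (k - 1), AltPerm.x ^ i *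
          ((AltPerm.x ^ (k - 1 - i) + AltPerm.U ((k : ℤ) - 3 - i)) /
              (AltPerm.U ((k : ℤ) - 1 - i) * AltPerm.U ((k : ℤ) - 2 - i)) *
              (∑ j ∈ Finset.range (k - 1 - i), AltPerm.U (j : ℤ) * AltPerm.U ((j : ℤ) + 1)) -
            AltPerm.x * AltPerm.U ((k : ℤ) - 2 - i)) ∧
    AltPerm.DU1 k =
      (AltPerm.x ^ (k - 1) + AltPerm.U ((k : ℤ) - 3)) / AltPerm.U ((k : ℤ) - 2) * AltPerm.UU1 k +
        AltPerm.U ((k : ℤ) - 2) / AltPerm.U ((k : ℤ) - 1) * AltPerm.DD1 (k - 1) +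
        AltPerm.x * AltPerm.U ((k : ℤ) - 3) *
            (AltPerm.x ^ (k - 2) + AltPerm.U ((k : ℤ) - 4)) /
          (AltPerm.U ((k : ℤ) - 2) * AltPerm.U ((k : ℤ) - 1)) ∧
    AltPerm.A1 k =
      1 / (AltPerm.x * AltPerm.U ((k : ℤ) - 1) ^ 2) *
        (AltPerm.x * AltPerm.U ((k : ℤ) - 3) *
            (AltPerm.U ((k : ℤ) - 3) + AltPerm.U ((k : ℤ) - 2)) +
          (1 + AltPerm.x) *
            ∑ m ∈ Finset.range (k - 3), AltPerm.U ((m : ℤ) + 1) * AltPerm.U (m : ℤ)) := by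
  obtain ⟨n, rfl⟩ := Nat.exists_eq_add_of_le' hk
  have e₁ : AltPerm.U (((n + 3 : ℕ) : ℤ) - 1) = PermList.V (n + 3) :=
    PermList.U_eq_V (by push_cast; ring)
  have e₂ : AltPerm.U (((n + 3 : ℕ) : ℤ) - 2) = PermList.V (n + 2) :=
    PermList.U_eq_V (by push_cast; ring)
  have e₃ : AltPerm.U (((n + 3 : ℕ) : ℤ) - 3) = PermList.V (n + 1) :=
    PermList.U_eq_V (by push_cast; ring)
  have e₄ : AltPerm.U (((n + 3 : ℕ) : ℤ) - 4) = PermList.V n :=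
    PermList.U_eq_V (by push_cast; ring)
  simp only [e₁, e₂, e₃, e₄, PermList.sum_U_eq_sumV, PermList.sum_U_eq_sumV',
    show n + 3 - 2 = n + 1 by omega, show n + 3 - 3 = n by omega, show n + 3 - 1 = n + 2 by omega]
  refine ⟨PermList.UD1_eq_sumV (n + 1), PermList.UU1_eq_sumV n, ?_, ?_, ?_⟩
  · refine (PermList.DD1_eq_sum (n + 1)).trans (congrArg _ (Finset.sum_congr rfl fun i hi => ?_))
    -- Writing `n + 1 = i + j` removes the truncated subtractions, so that the integer indices match
    -- those of `V`.
    obtain ⟨j, hj⟩ := Nat.exists_eq_add_of_le (Nat.lt_succ_iff.1 (Finset.mem_range.1 hi))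
    rw [hj, PermList.termDD, PermList.U_eq_V (n := j), PermList.U_eq_V (n := j + 2),
      PermList.U_eq_V (n := j + 1), show n + 2 - i = j + 1 by omega,
      show i + j - i = j by omega]
    all_goals push_cast; omega
  · rw [PermList.DU1_eq, PermList.UU1_eq, PermList.DD1_eq]
    exact PermList.F_one_false_true n
  · exact PermList.A1_eq_sumV n
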